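/- Let $n\ge 2$ and $d\ge 1$. Let $Q\subset\mathbb{R}^n$ be the closed cube with center $(\tfrac12,0,\dots,0)$, side $\tfrac1{10}$ and sides parallel to the axes, and put $M:=\overline{B_1(0)\setminus Q}\times\{0\}\subset\mathbb{R}^{n}\times\mathbb{R}^d=\mathbb{R}^{n+d}$. Let $\mu:=\mathcal{H}^n\llcorner M$, let $B_r(x)$ be open balls of $\mathbb{R}^{n+d}$, and let $T_yM$ be the approximate tangent space of $M$ at $y$, i.e. the $n$-dimensional linear subspace with $\lim_{h\downarrow0}h^{-n}\int_M f(h^{-1}(y'-y))\,d\mathcal{H}^n(y')=\int_{T_yM}f\,d\mathcal{H}^n$ for all $f\in C^1_c(\mathbb{R}^{n+d})$ (it is unique if it exists, and it exists for $\mu$-a.e. $y$). Write $f_{x,r}:=\mu(B_r(x))^{-1}\int_{B_r(x)}f\,d\mu$. Then: 1. $M$ is not Reifenberg flat: for no $\epsilon\in(0,1)$ is $M$ $\epsilon$-Reifenberg flat, where $\epsilon$-Reifenberg flat means that for all $x\in M$ and $0<r\le10^{-4}$ there is an $n$-dimensional affine subspace $P\ni x$ such that $d(y,P)\le\epsilon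 r$ for all $y\in M\cap B_r(x)$ and $d(y,M)\le\epsilon r$ for all $y\in P\cap B_r(x)$. (Every set is $1$-Reifenberg flat.) 2. $M\subset B_2(0)$, $0\in M$, and $M$ is countably $n$-rectifiable: it is $\mathcal{H}^n$-measurable and, up to an $\mathcal{H}^n$-null set, it is covered by countably many Lipschitz images of subsets of $\mathbb{R}^n$. 3. There are constants $C_M\ge1$, $C_P>0$ and $\lambda\ge1$ such that (a) $M$ is $n$-Ahlfors regular: $M$ is closed and $C_M^{-1}r^n\le\mu(B_r(x))\le C_Mr^n$ for all $x\in M$, $0<r\le1$; (b) for all $x\in M$, $r>0$ and every Lipschitz $f:\mathbb{R}^{n+d}\to\mathbb{R}$, $$\frac1{\mu(B_r(x))}\int_{B_r(x)}|f-f_{x,r}|\,d\mu\le C_P\,r\Big(\frac1{\mu(B_{\lambda r}(x))}\int_{B_{\lambda r}(x)}|\nabla^Mf|^2\,d\mu\Big)^{1/2},$$ where $\nabla^Mf(y)$ is the gradient at $y$ of the restriction of $f$ to $y+T_yM$; (c) for every $\epsilon_0>0$ (with $C_M,C_P,\lambda$ independent of $\epsilon_0$), $$\int_0^1\Big(\frac1{\mu(B_r(x))}\int_{B_r(x)}|\pi_{T_yM}-A_{x,r}|^2\,d\mu(y)\Big)\frac{dr}{r}<\epsilon_0^2\qquad\text{for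 all }x\in M\cap B_1(0),$$ where $\pi_{T_yM}$ is the matrix of the orthogonal projection onto $T_yM$ in the standard basis, $A_{x,r}$ is its entrywise average over $B_r(x)$ with respect to $\mu$, and $|\cdot|$ is the Frobenius norm. -/

import Mathlib

open Set Filter Topology MeasureTheory

/-- Carathéodory measurability of `M` with respect to the `n`-dimensional Hausdorff measure,
together with a covering of `M`, up to an `ℋⁿ`-null set, by countably many Lipschitz images of
subsets of `ℝⁿ`. -/
def IsCountablyRectifiable (n : ℕ) {N : ℕ} (M : Set (EuclideanSpace ℝ (Fin N))) : Prop :=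
  (μHE[n] : Measure (EuclideanSpace ℝ (Fin N))).toOuterMeasure.IsCaratheodory M ∧
  ∃ (M₀ : Set (EuclideanSpace ℝ (Fin N))) (A : ℕ → Set (EuclideanSpace ℝ (Fin n)))
    (f : ℕ → EuclideanSpace ℝ (Fin n) → EuclideanSpace ℝ (Fin N)),
    μHE[n] M₀ = 0 ∧ (∀ i, ∃ K : NNReal, LipschitzOnWith K (f i) (A i)) ∧
    M ⊆ M₀ ∪ ⋃ i, f i '' A i

/-- `M` is `n`-Ahlfors regular with constant `C`: it is closed, and
`C⁻¹ rⁿ ≤ ℋⁿ(M ∩ B_r(x)) ≤ C rⁿ` for all `x ∈ M` and `0 < r ≤ 1`. -/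
def IsAhlforsRegular (n : ℕ) {N : ℕ} (M : Set (EuclideanSpace ℝ (Fin N))) (C : ℝ) : Prop :=
  IsClosed M ∧ ∀ x ∈ M, ∀ r : ℝ, 0 < r → r ≤ 1 →
    ENNReal.ofReal (C⁻¹ * r ^ n) ≤ (μHE[n].restrict M) (Metric.ball x r) ∧
    (μHE[n].restrict M) (Metric.ball x r) ≤ ENNReal.ofReal (C * r ^ n)

/-- The `n`-dimensional linear subspace `P` is the approximate tangent space of `M` at `x`.
(Integrability only says that the integrals over `M` at small scales make sense.) -/
def IsApproxTangentSpace (n : ℕ) {N : ℕ} (M : Set (EuclideanSpace ℝ (Fin N)))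
    (x : EuclideanSpace ℝ (Fin N)) (P : Submodule ℝ (EuclideanSpace ℝ (Fin N))) : Prop :=
  Module.finrank ℝ P = n ∧
  ∀ f : EuclideanSpace ℝ (Fin N) → ℝ, ContDiff ℝ 1 f → HasCompactSupport f →
    (∀ᶠ h : ℝ in 𝓝[>] 0, IntegrableOn (fun y => f (h⁻¹ • (y - x))) M μHE[n]) ∧
    Tendsto (fun h : ℝ => (h ^ n)⁻¹ * ∫ y in M, f (h⁻¹ • (y - x)) ∂μHE[n]) (𝓝[>] 0)
      (𝓝 (∫ y in (P : Set (EuclideanSpace ℝ (Fin N))), f y ∂μHE[n]))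

open Classical in
/-- The approximate tangent space `T_y M`. It is unique when it exists; at points where it does
not exist (an `ℋⁿ`-null subset of a closed rectifiable Ahlfors regular set) the value is the
zero subspace. -/
noncomputable def approxTangentSpace (n : ℕ) {N : ℕ} (M : Set (EuclideanSpace ℝ (Fin N)))
    (y : EuclideanSpace ℝ (Fin N)) : Submodule ℝ (EuclideanSpace ℝ (Fin N)) :=
  if h : ∃ P, IsApproxTangentSpace n M y P then h.choose else ⊥

/-- The tangential derivative `∇^M f(y)`: the gradient at `y` of the restriction of `f` to the
affine subspace `y + T_y M`, as a vector of `T_y M`. -/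
noncomputable def tangentialGradient (n : ℕ) {N : ℕ} (M : Set (EuclideanSpace ℝ (Fin N)))
    (f : EuclideanSpace ℝ (Fin N) → ℝ) (y : EuclideanSpace ℝ (Fin N)) :
    approxTangentSpace n M y :=
  gradient (fun v : approxTangentSpace n M y => f (y + (v : EuclideanSpace ℝ (Fin N)))) 0

/-- The Poincaré-type inequality on `M` with constant `C` and dilation constant `lam`. -/
def SatisfiesPoincare (n : ℕ) {N : ℕ} (M : Set (EuclideanSpace ℝ (Fin N))) (C lam : ℝ) : Prop :=
  ∀ x ∈ M, ∀ r : ℝ, 0 < r → ∀ f : EuclideanSpace ℝ (Fin N) → ℝ,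
    (∃ K : NNReal, LipschitzWith K f) →
    ⨍ y in Metric.ball x r,
        |f y - ⨍ z in Metric.ball x r, f z ∂(μHE[n].restrict M)| ∂(μHE[n].restrict M) ≤
      C * r * √(⨍ y in Metric.ball x (lam * r),
        ‖tangentialGradient n M f y‖ ^ 2 ∂(μHE[n].restrict M))

/-- The matrix `(a_{ij}(y))` of the orthogonal projection onto `T_y M` in the standard basis. -/
noncomputable def tangentProjection (n : ℕ) {N : ℕ} (M : Set (EuclideanSpace ℝ (Fin N)))
    (y : EuclideanSpace ℝ (Fin N)) : Matrix (Fin N) (Fin N) ℝ :=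
  fun i j => (approxTangentSpace n M y).starProjection (EuclideanSpace.single j 1) i

/-- The matrix `A_{x,r}` of the averages over `M ∩ B_r(x)` of the functions `a_{ij}`. -/
noncomputable def averageProjection (n : ℕ) {N : ℕ} (M : Set (EuclideanSpace ℝ (Fin N)))
    (x : EuclideanSpace ℝ (Fin N)) (r : ℝ) : Matrix (Fin N) (Fin N) ℝ :=
  fun i j => ⨍ y in Metric.ball x r, tangentProjection n M y i j ∂(μHE[n].restrict M)

/-- The Carleson-type condition with bound `ε²`, for the squared Frobenius norm of
`π_{T_y M} - A_{x,r}`, at all points `x ∈ M ∩ B_1(0)`. -/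
def SatisfiesCarleson (n : ℕ) {N : ℕ} (M : Set (EuclideanSpace ℝ (Fin N))) (ε : ℝ) : Prop :=
  ∀ x ∈ M ∩ Metric.ball 0 1,
    ∫⁻ r in Ioo (0 : ℝ) 1,
      (⨍⁻ y in Metric.ball x r,
        ENNReal.ofReal (∑ i, ∑ j,
          (tangentProjection n M y i j - averageProjection n M x r i j) ^ 2)
        ∂(μHE[n].restrict M)) / ENNReal.ofReal r
      < ENNReal.ofReal (ε ^ 2)

/-- `M` is `ε`-Reifenberg flat (in dimension `n`, at scales up to `10⁻⁴`). -/
def IsReifenbergFlat (n : ℕ) {N : ℕ} (M : Set (EuclideanSpace ℝ (Fin N))) (ε : ℝ) : Prop :=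
  ∀ x ∈ M, ∀ r : ℝ, 0 < r → r ≤ 1 / 10 ^ 4 →
    ∃ P : AffineSubspace ℝ (EuclideanSpace ℝ (Fin N)),
      Module.finrank ℝ P.direction = n ∧ x ∈ P ∧
      (∀ y ∈ M ∩ Metric.ball x r,
        Metric.infDist y (P : Set (EuclideanSpace ℝ (Fin N))) ≤ ε * r) ∧
      (∀ y ∈ (P : Set (EuclideanSpace ℝ (Fin N))) ∩ Metric.ball x r, Metric.infDist y M ≤ ε * r)

/-- The closed cube in `ℝⁿ` with center `(1/2, 0, …, 0)` and side `1/10`. -/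
def smallCube (n : ℕ) : Set (EuclideanSpace ℝ (Fin n)) :=
  {x | ∀ i : Fin n, |x i - (if (i : ℕ) = 0 then 1 / 2 else 0)| ≤ 1 / 20}

/-- The set `closure (B_1(0) \ Q) × {0} ⊆ ℝⁿ × ℝᵈ`, where `Q` is the cube above. -/
def perforatedDisc (n d : ℕ) : Set (EuclideanSpace ℝ (Fin (n + d))) :=
  (fun x : EuclideanSpace ℝ (Fin n) =>
    (WithLp.toLp 2 (Fin.append (fun i => x i) (fun _ : Fin d => (0 : ℝ))) :
      EuclideanSpace ℝ (Fin (n + d)))) ''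
    closure (Metric.ball 0 1 \ smallCube n)

/-! The set `M` is a flat isometric copy of the closure of Ω = B₁ \ Q, and it differs from the copy
of Ω by a null set. Ω is open, so the blow-ups of `M` at its points are eventually equal to the
horizontal plane. The approximate tangent space is therefore constant almost everywhere, the
projections do not oscillate, and the Carleson integral is 0, below every ε₀². Flatness fails at the
hole. At the centre of a face of Q, every `n`-plane contains a unit vector with no component along
the face that points weakly into the hole. Moving along it by almost `r` leads to a point whose
distance from `M` exceeds ε r.

The analytic part is the Poincaré inequality, which must survive the removal of Q. Ω is the union of
the 2n convex pieces of the ball that lie beyond the faces of Q (`iUnion_beyondFace`). On a convex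
set the inequality follows by integrating the derivative along segments (`Convex.doubleOsc_le`).
Pieces beyond faces in different directions overlap in a ball of fixed radius. Opposite pieces are a
fixed distance apart and are linked through a third piece, which exists because n ≥ 2. Chaining
oscillations through these overlaps (`doubleOsc_mul_le`, `IsLinkedConvexFamily.exists_link`) gives
`IsLinkedConvexFamily.poincare`. The same interior balls give Ahlfors regularity, and everything is
transported to `M` by `zeroExtension`. -/

open scoped ENNReal NNReal

/-! ### Double oscillation integrals -/

section DoubleOsc

variable {X : Type*} [MeasurableSpace X] (μ : Measure X)

/-- The double integral of `|g x - g y|` over `A × B`. -/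
noncomputable def doubleOsc (g : X → ℝ) (A B : Set X) : ℝ≥0∞ :=
  ∫⁻ x in A, ∫⁻ y in B, ‖g x - g y‖ₑ ∂μ ∂μ

theorem doubleOsc_mono (g : X → ℝ) {A A' B B' : Set X} (hA : A ⊆ A') (hB : B ⊆ B') :
    doubleOsc μ g A B ≤ doubleOsc μ g A' B' :=
  (lintegral_mono fun _ => lintegral_mono_set hB).trans (lintegral_mono_set hA)

/-- The triangle inequality through an intermediate point w, integrated over A × B × W. This is the
chaining step: W will be an overlap of two convex pieces. -/
theorem doubleOsc_mul_le [SFinite μ] {g : X → ℝ} (hg : Measurable g) (A B W : Set X) :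
    doubleOsc μ g A B * μ W ≤ μ B * doubleOsc μ g A W + μ A * doubleOsc μ g W B := by
  have hm2 : Measurable fun p : X × X => ‖g p.1 - g p.2‖ₑ := by fun_prop
  have hmB : Measurable fun x => ∫⁻ y in B, ‖g x - g y‖ₑ ∂μ := hm2.lintegral_prod_right'
  have hmW : Measurable fun x => ∫⁻ y in W, ‖g x - g y‖ₑ ∂μ := hm2.lintegral_prod_right'
  have step : ∀ x, (∫⁻ y in B, ‖g x - g y‖ₑ ∂μ) * μ W ≤
      μ B * (∫⁻ w in W, ‖g x - g w‖ₑ ∂μ) + doubleOsc μ g W B := fun x => by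
    calc (∫⁻ y in B, ‖g x - g y‖ₑ ∂μ) * μ W
        = ∫⁻ w in W, ∫⁻ y in B, ‖g x - g y‖ₑ ∂μ ∂μ := by rw [setLIntegral_const]
      _ ≤ ∫⁻ w in W, (μ B * ‖g x - g w‖ₑ + ∫⁻ y in B, ‖g w - g y‖ₑ ∂μ) ∂μ := by
          refine lintegral_mono fun w => ?_
          rw [mul_comm, ← setLIntegral_const, ← lintegral_add_left measurable_const]
          refine lintegral_mono fun y => ?_
          rw [← sub_add_sub_cancel (g x) (g w) (g y)]
          exact enorm_add_le _ _
      _ = _ := by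
          rw [lintegral_add_right _ hmB, lintegral_const_mul _ (by fun_prop)]
          rfl
  calc doubleOsc μ g A B * μ W = ∫⁻ x in A, (∫⁻ y in B, ‖g x - g y‖ₑ ∂μ) * μ W ∂μ := by
        rw [doubleOsc, lintegral_mul_const _ hmB]
    _ ≤ ∫⁻ x in A, (μ B * (∫⁻ w in W, ‖g x - g w‖ₑ ∂μ) + doubleOsc μ g W B) ∂μ :=
        lintegral_mono step
    _ = _ := by
        rw [lintegral_add_right _ measurable_const, lintegral_const_mul _ hmW,
          setLIntegral_const, mul_comm (doubleOsc μ g W B)]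
        rfl

end DoubleOsc

/-! ### The L¹ Poincaré inequality on convex sets -/

section ConvexPoincare

variable {E : Type*} [NormedAddCommGroup E] [NormedSpace ℝ E]

/-- The increment of a Lipschitz function over half of a segment is controlled by the integral of
the derivative, if the function is differentiable at almost all points of the segment. -/
theorem LipschitzWith.enorm_sub_midpoint_le {g : E → ℝ} {K : ℝ≥0} (hg : LipschitzWith K g)
    (x y : E)
    (hd : ∀ᵐ t : ℝ ∂volume.restrict (Icc 0 (1 / 2)),
      DifferentiableAt ℝ g ((1 - t) • x + t • y)) :
    ‖g x - g ((1 / 2 : ℝ) • x + (1 / 2 : ℝ) • y)‖ₑ ≤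
      ‖x - y‖ₑ * ∫⁻ t in Icc (0 : ℝ) (1 / 2), ‖fderiv ℝ g ((1 - t) • x + t • y)‖ₑ := by
  set c : ℝ → E := fun t => (1 - t) • x + t • y with hc
  have hcd : ∀ t, HasDerivAt c (y - x) t := fun t => by
    have h1 : HasDerivAt (fun t : ℝ => (1 - t) • x) ((-1 : ℝ) • x) t :=
      ((hasDerivAt_id t).const_sub 1).smul_const x
    have h2 : HasDerivAt (fun t : ℝ => t • y) ((1 : ℝ) • y) t :=
      (hasDerivAt_id t).smul_const y
    have := h1.add h2
    convert! this using 1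
    simp [sub_eq_neg_add]
  have hcl : LipschitzWith ‖y - x‖₊ c := by
    refine LipschitzWith.of_dist_le_mul fun s t => ?_
    have : c s - c t = (s - t) • (y - x) := by simp only [hc]; module
    rw [dist_eq_norm, this, norm_smul, mul_comm, coe_nnnorm, dist_eq_norm]
  have hac : AbsolutelyContinuousOnInterval (g ∘ c) 0 (1 / 2) :=
    ((hg.comp hcl).lipschitzOnWith (s := uIcc 0 (1 / 2))).absolutelyContinuousOnInterval
  have hftc := hac.integral_deriv_eq_sub
  have h0 : (g ∘ c) 0 = g x := by simp [hc]
  have h1 : (g ∘ c) (1 / 2) = g ((1 / 2 : ℝ) • x + (1 / 2 : ℝ) • y) := by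
    simp only [hc, Function.comp]; norm_num
  rw [h0, h1, intervalIntegral.integral_of_le (by norm_num)] at hftc
  rw [← enorm_neg, neg_sub, ← hftc]
  refine (enorm_integral_le_lintegral_enorm _).trans ?_
  rw [← lintegral_const_mul' _ _ enorm_ne_top, restrict_Ioc_eq_restrict_Icc]
  refine lintegral_mono_ae ?_
  filter_upwards [hd] with t ht
  have : deriv (g ∘ c) t = fderiv ℝ g (c t) (y - x) :=
    (ht.hasFDerivAt.comp_hasDerivAt t (hcd t)).deriv
  rw [this, mul_comm, ← enorm_neg (x - y), neg_sub]
  exact ContinuousLinearMap.le_opENorm _ _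

variable [MeasurableSpace E] [BorelSpace E] [FiniteDimensional ℝ E] (μ : Measure E)
  [μ.IsAddHaarMeasure]

open Module in
theorem lintegral_comp_smul_add (f : E → ℝ≥0∞) {s : ℝ} (hs : s ≠ 0) (y : E) (hf : Measurable f) :
    ∫⁻ x, f (s • x + y) ∂μ = ENNReal.ofReal |(s ^ finrank ℝ E)⁻¹| * ∫⁻ x, f x ∂μ := by
  have h1 : ∫⁻ x, f (s • x + y) ∂μ = ∫⁻ x, f (x + y) ∂(Measure.map (s • ·) μ) := by
    rw [lintegral_map (by fun_prop) (by fun_prop)]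
  rw [h1, Measure.map_addHaar_smul μ hs, lintegral_smul_measure, lintegral_add_right_eq_self]
  rfl

/-- Rademacher and Fubini: for each fixed t ≤ 1/2 the map x ↦ (1 - t)x + ty is a nondegenerate
homothety, so the preimage of the null set of bad points is null. Then the quantifiers over t and x
are exchanged. -/
theorem LipschitzWith.ae_ae_differentiableAt_segment {g : E → ℝ} {K : ℝ≥0}
    (hg : LipschitzWith K g) (y : E) :
    ∀ᵐ x ∂μ, ∀ᵐ t : ℝ ∂volume.restrict (Icc 0 (1 / 2)),
      DifferentiableAt ℝ g ((1 - t) • x + t • y) := by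
  have hm : MeasurableSet {p : ℝ × E | DifferentiableAt ℝ g ((1 - p.1) • p.2 + p.1 • y)} :=
    (measurableSet_of_differentiableAt ℝ g).preimage
      (f := fun p : ℝ × E => (1 - p.1) • p.2 + p.1 • y) (by fun_prop)
  refine (Measure.ae_ae_comm (μ := volume.restrict (Icc (0 : ℝ) (1 / 2))) (ν := μ) hm).1 ?_
  filter_upwards [ae_restrict_mem measurableSet_Icc] with t ht
  have hs : (1 - t) ≠ 0 := by linarith [ht.2]
  have h0 : μ {x | ¬ DifferentiableAt ℝ g x} = 0 := hg.ae_differentiableAt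
  have hms := (measurableSet_of_differentiableAt ℝ g).compl
  change μ {x | ¬ DifferentiableAt ℝ g ((1 - t) • x + t • y)} = 0
  have key := lintegral_comp_smul_add μ ({x | DifferentiableAt ℝ g x}ᶜ.indicator 1) hs (t • y)
    (measurable_one.indicator hms)
  rw [lintegral_indicator_one hms, show μ {x | DifferentiableAt ℝ g x}ᶜ = 0 from h0, mul_zero]
    at key
  have h2 : (fun x => {x | DifferentiableAt ℝ g x}ᶜ.indicator (1 : E → ℝ≥0∞)
      ((1 - t) • x + t • y)) =
      {x | ¬ DifferentiableAt ℝ g ((1 - t) • x + t • y)}.indicator 1 := by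
    ext x
    by_cases h : DifferentiableAt ℝ g ((1 - t) • x + t • y) <;> simp [indicator, h]
  rw [h2, lintegral_indicator_one] at key
  · exact key
  · exact hms.preimage (f := fun x : E => (1 - t) • x + t • y) (by fun_prop)

-- For fixed t, convexity keeps the point in U, and the substitution costs (1 - t)⁻ⁿ ≤ 2ⁿ. This
-- bound is the reason for stopping at the midpoint: it would blow up as t → 1.
open Module in
theorem Convex.lintegral_lintegral_segment_le {U : Set E} (hU : Convex ℝ U)
    (hm : MeasurableSet U) {h : E → ℝ≥0∞} (hh : Measurable h) {y : E} (hy : y ∈ U) :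
    ∫⁻ x in U, ∫⁻ t in Icc (0 : ℝ) (1 / 2), h ((1 - t) • x + t • y) ∂volume ∂μ ≤
      2 ^ finrank ℝ E * ∫⁻ x in U, h x ∂μ := by
  rw [lintegral_lintegral_swap (by fun_prop)]
  calc _ ≤ ∫⁻ _ in Icc (0 : ℝ) (1 / 2), 2 ^ finrank ℝ E * ∫⁻ x in U, h x ∂μ := by
        refine setLIntegral_mono' measurableSet_Icc fun t ht => ?_
        have hs : 0 < 1 - t := by linarith [ht.2]
        have h1 : ∫⁻ x in U, h ((1 - t) • x + t • y) ∂μ ≤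
            ∫⁻ x, U.indicator h ((1 - t) • x + t • y) ∂μ := by
          rw [← lintegral_indicator hm]
          refine lintegral_mono fun x => indicator_le (g := fun x => U.indicator h ((1 - t) • x + t • y)) (fun x hx => ?_) x
          rw [indicator_of_mem (hU hx hy hs.le ht.1 (by ring))]
        refine h1.trans ?_
        rw [lintegral_comp_smul_add μ _ hs.ne' _ (hh.indicator hm), lintegral_indicator hm]
        gcongr
        rw [abs_of_nonneg (by positivity), ← inv_pow]
        refine (ENNReal.ofReal_le_ofReal (pow_le_pow_left₀ (by positivity)
          (show (1 - t)⁻¹ ≤ 2 from ?_) _)).trans ?_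
        · rw [inv_le_comm₀ hs (by norm_num)]; linarith [ht.2]
        · rw [ENNReal.ofReal_pow (by norm_num)]; simp
    _ ≤ _ := by
        rw [setLIntegral_const, Real.volume_Icc]
        refine mul_le_of_le_one_right' ?_
        rw [ENNReal.ofReal_le_one]; norm_num

open Module in
/-- The `L¹` Poincaré inequality on a bounded convex set. -/
theorem Convex.doubleOsc_le {U : Set E} (hU : Convex ℝ U) (hm : MeasurableSet U)
    {D : ℝ≥0∞} (hD : ∀ x ∈ U, ∀ y ∈ U, edist x y ≤ D)
    {g : E → ℝ} {K : ℝ≥0} (hg : LipschitzWith K g) :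
    doubleOsc μ g U U ≤
      2 * 2 ^ finrank ℝ E * D * μ U * ∫⁻ x in U, ‖fderiv ℝ g x‖ₑ ∂μ := by
  have hgm : Measurable g := hg.continuous.measurable
  have hhm : Measurable fun x => ‖fderiv ℝ g x‖ₑ := (measurable_fderiv ℝ g).enorm
  set I := ∫⁻ x in U, ‖fderiv ℝ g x‖ₑ ∂μ
  have hmid : ∀ y ∈ U, ∫⁻ x in U, ‖g x - g ((1 / 2 : ℝ) • x + (1 / 2 : ℝ) • y)‖ₑ ∂μ ≤
      D * (2 ^ finrank ℝ E * I) := fun y hy => by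
    refine le_trans ?_ (mul_le_mul_right (hU.lintegral_lintegral_segment_le μ hm hhm hy) D)
    have hmm : Measurable fun x => ∫⁻ t in Icc (0 : ℝ) (1 / 2),
        ‖fderiv ℝ g ((1 - t) • x + t • y)‖ₑ := by
      refine Measurable.lintegral_prod_right'
        (f := fun p : E × ℝ => ‖fderiv ℝ g ((1 - p.2) • p.1 + p.2 • y)‖ₑ) ?_
      exact hhm.comp (by fun_prop : Measurable fun p : E × ℝ => (1 - p.2) • p.1 + p.2 • y)
    rw [← lintegral_const_mul _ hmm]
    refine lintegral_mono_ae ?_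
    filter_upwards [ae_restrict_mem hm, ae_restrict_of_ae
      (hg.ae_ae_differentiableAt_segment μ y)] with x hx hd
    refine (hg.enorm_sub_midpoint_le x y hd).trans ?_
    gcongr
    rw [← edist_eq_enorm_sub]; exact hD x hx y hy
  have hm1 : Measurable fun p : E × E =>
      ‖g p.1 - g ((1 / 2 : ℝ) • p.1 + (1 / 2 : ℝ) • p.2)‖ₑ := by fun_prop
  have hA : ∫⁻ y in U, ∫⁻ x in U, ‖g x - g ((1 / 2 : ℝ) • x + (1 / 2 : ℝ) • y)‖ₑ ∂μ ∂μ ≤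
      D * (2 ^ finrank ℝ E * I) * μ U := by
    rw [← setLIntegral_const]
    exact setLIntegral_mono' hm hmid
  calc doubleOsc μ g U U
      -- Each pair is compared through its midpoint. The two halves are exchanged by swapping x and
      -- y, so `hA` bounds both.
      ≤ ∫⁻ x in U, ∫⁻ y in U, (‖g x - g ((1 / 2 : ℝ) • x + (1 / 2 : ℝ) • y)‖ₑ +
          ‖g y - g ((1 / 2 : ℝ) • y + (1 / 2 : ℝ) • x)‖ₑ) ∂μ ∂μ := by
        refine lintegral_mono fun x => lintegral_mono fun y => ?_
        rw [add_comm ((1 / 2 : ℝ) • y), enorm_sub_rev (g y)]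
        rw [← sub_add_sub_cancel (g x) (g ((1 / 2 : ℝ) • x + (1 / 2 : ℝ) • y)) (g y)]
        exact enorm_add_le _ _
    _ = (∫⁻ x in U, ∫⁻ y in U, ‖g x - g ((1 / 2 : ℝ) • x + (1 / 2 : ℝ) • y)‖ₑ ∂μ ∂μ) +
        ∫⁻ x in U, ∫⁻ y in U, ‖g y - g ((1 / 2 : ℝ) • y + (1 / 2 : ℝ) • x)‖ₑ ∂μ ∂μ := by
        rw [← lintegral_add_left hm1.lintegral_prod_right']
        refine lintegral_congr fun x => ?_
        exact lintegral_add_left (by fun_prop) _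
    _ ≤ D * (2 ^ finrank ℝ E * I) * μ U + D * (2 ^ finrank ℝ E * I) * μ U := by
        refine add_le_add ?_ hA
        rw [lintegral_lintegral_swap hm1.aemeasurable]
        exact hA
    _ = _ := by ring

end ConvexPoincare

/-! ### Averages against double integrals -/

section Average

variable {X : Type*} [MeasurableSpace X]

theorem average_le_sqrt_average_sq (m : Measure X) [IsFiniteMeasure m] {h : X → ℝ}
    (hi : Integrable h m) (hi2 : Integrable (fun x => h x ^ 2) m) :
    ⨍ x, h x ∂m ≤ √(⨍ x, h x ^ 2 ∂m) := by
  rcases eq_zero_or_neZero m with rfl | hm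
  · simp
  have := (even_two.convexOn_pow (𝕜 := ℝ)).map_average_le (μ := m) (f := h)
    (by fun_prop) isClosed_univ (by simp) hi hi2
  exact (le_abs_self _).trans (Real.abs_le_sqrt this)

/-- The total mass times g(x) - avg g is the integral of g(x) - g(y) over y. This reduces the mean
oscillation to `doubleOsc`, which can be split over a cover. -/
theorem measure_univ_mul_lintegral_sub_average_le (m : Measure X) [IsFiniteMeasure m]
    {g : X → ℝ} (hi : Integrable g m) :
    m univ * ∫⁻ x, ‖g x - ⨍ y, g y ∂m‖ₑ ∂m ≤ ∫⁻ x, ∫⁻ y, ‖g x - g y‖ₑ ∂m ∂m := by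
  rw [← lintegral_const_mul' _ _ (measure_ne_top m _)]
  refine lintegral_mono fun x => ?_
  have h1 : ∫ y, (g x - g y) ∂m = m.real univ * (g x - ⨍ y, g y ∂m) := by
    rw [integral_sub (integrable_const _) hi, integral_const, mul_sub, smul_eq_mul,
      ← smul_eq_mul (m.real univ) (⨍ y, g y ∂m), measure_smul_average]
  have h2 : m univ * ‖g x - ⨍ y, g y ∂m‖ₑ = ‖m.real univ * (g x - ⨍ y, g y ∂m)‖ₑ := by
    rw [enorm_mul, Real.enorm_of_nonneg measureReal_nonneg, Measure.real,
      ENNReal.ofReal_toReal (measure_ne_top m _)]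
  rw [h2, ← h1]
  exact enorm_integral_le_lintegral_enorm _

theorem doubleOsc_iUnion_le {ι : Type*} [Fintype ι] (μ : Measure X) [SFinite μ] {g : X → ℝ}
    (hg : Measurable g) (A : ι → Set X) :
    doubleOsc μ g (⋃ i, A i) (⋃ i, A i) ≤ ∑ i, ∑ j, doubleOsc μ g (A i) (A j) := by
  have hm2 : Measurable fun p : X × X => ‖g p.1 - g p.2‖ₑ := by fun_prop
  refine (lintegral_iUnion_le _ _).trans ?_
  rw [tsum_fintype]
  refine Finset.sum_le_sum fun i _ => ?_
  unfold doubleOsc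
  rw [← lintegral_finsetSum _ (fun j _ => hm2.lintegral_prod_right')]
  refine lintegral_mono fun x => (lintegral_iUnion_le _ _).trans ?_
  rw [tsum_fintype]

end Average

/-! ### Poincaré inequality and Ahlfors regularity for linked families of convex sets -/

section ConvexCover

variable {E : Type*} [NormedAddCommGroup E] [NormedSpace ℝ E]

/-- The homothety of ratio s centred at a point p of U near x carries the ball about z into U, by
convexity. With s = min r 1 / 8 the image also stays inside the ball about x. -/
theorem Convex.exists_ball_subset_inter_ball {U : Set E} (hU : Convex ℝ U) {z : E} {ρ : ℝ}
    (hρ : 0 < ρ) (hρ1 : ρ ≤ 1) (hz : Metric.ball z ρ ⊆ U) (hU1 : U ⊆ Metric.ball 0 1) {x : E}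
    (hx : x ∈ closure U) {r : ℝ} (hr : 0 < r) :
    ∃ w, Metric.ball w (ρ / 8 * min r 1) ⊆ U ∩ Metric.ball x r := by
  obtain ⟨p, hp, hxp⟩ := Metric.mem_closure_iff.1 hx (r / 2) (by positivity)
  obtain ⟨s, hs⟩ : ∃ s, s = min r 1 / 8 := ⟨_, rfl⟩
  have hm : 0 < min r 1 := lt_min hr one_pos
  have hs0 : 0 < s := by rw [hs]; positivity
  have hsr : s ≤ r / 8 := by rw [hs]; linarith [min_le_left r 1]
  have hs1 : s ≤ 1 / 8 := by rw [hs]; linarith [min_le_right r 1]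
  have hzU : z ∈ U := hz (Metric.mem_ball_self hρ)
  have hpz : dist z p < 2 := by
    have h1 := mem_ball_zero_iff.1 (hU1 hzU)
    have h2 := mem_ball_zero_iff.1 (hU1 hp)
    rw [dist_eq_norm]; linarith [norm_sub_le z p]
  refine ⟨(1 - s) • p + s • z, fun u hu => ?_⟩
  rw [Metric.mem_ball, dist_eq_norm] at hu
  have hu' : ‖u - ((1 - s) • p + s • z)‖ < s * ρ := hu.trans_eq (by rw [hs]; ring)
  constructor
  · have : u = (1 - s) • p + s • (z + s⁻¹ • (u - ((1 - s) • p + s • z))) := by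
      rw [smul_add, smul_inv_smul₀ hs0.ne']; abel
    rw [this]
    refine hU hp (hz ?_) (by linarith) hs0.le (by ring)
    rw [Metric.mem_ball, dist_eq_norm, add_sub_cancel_left, norm_smul, norm_inv,
      Real.norm_of_nonneg hs0.le, inv_mul_lt_iff₀ hs0]
    exact hu'
  · have h1 : ‖((1 - s) • p + s • z) - p‖ = s * dist z p := by
      rw [show ((1 - s) • p + s • z) - p = s • (z - p) by module, norm_smul,
        Real.norm_of_nonneg hs0.le, dist_eq_norm]
    have h2 : dist u x ≤ ‖u - ((1 - s) • p + s • z)‖ + ‖((1 - s) • p + s • z) - p‖ + dist x p := by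
      rw [dist_comm x p]
      simpa only [dist_eq_norm] using dist_triangle4 u ((1 - s) • p + s • z) p x
    rw [Metric.mem_ball]
    nlinarith

/-- Linear regularity of a pair of convex sets whose intersection contains a ball. -/
theorem Convex.exists_mem_inter_dist_le {U V : Set E} (hU : Convex ℝ U) (hV : Convex ℝ V)
    {z : E} {ρ δ : ℝ} (hρ : 0 < ρ) (hz : Metric.ball z ρ ⊆ U ∩ V) {p q : E} (hp : p ∈ U)
    (hq : q ∈ V) (hpq : dist p q < δ) :
    ∃ w ∈ U ∩ V, dist w p ≤ δ / ρ * dist z p := by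
  have hδ : 0 < δ := dist_nonneg.trans_lt hpq
  have hsum : ρ / (ρ + δ) + δ / (ρ + δ) = 1 := by field_simp
  refine ⟨(ρ / (ρ + δ)) • p + (δ / (ρ + δ)) • z, ⟨?_, ?_⟩, ?_⟩
  · exact hU hp (hz (Metric.mem_ball_self hρ)).1 (by positivity) (by positivity) hsum
  -- The same point is a convex combination of q and a perturbation of z; the ball about z absorbs
  -- the discrepancy between p and q.
  · have h1 : (ρ / (ρ + δ)) • p + (δ / (ρ + δ)) • z =
        (ρ / (ρ + δ)) • q + (δ / (ρ + δ)) • (z + (ρ / δ) • (p - q)) := by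
      rw [smul_add, smul_smul, show δ / (ρ + δ) * (ρ / δ) = ρ / (ρ + δ) by field_simp]
      module
    rw [h1]
    refine hV hq (hz ?_).2 (by positivity) (by positivity) hsum
    rw [Metric.mem_ball, dist_eq_norm, add_sub_cancel_left, norm_smul,
      Real.norm_of_nonneg (by positivity), ← dist_eq_norm, div_mul_eq_mul_div, div_lt_iff₀ hδ]
    exact mul_lt_mul_of_pos_left hpq hρ
  · have h1 : (ρ / (ρ + δ)) • p + (δ / (ρ + δ)) • z - p = (δ / (ρ + δ)) • (z - p) := by
      have : ρ / (ρ + δ) = 1 - δ / (ρ + δ) := by linarith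
      rw [this]; module
    rw [dist_eq_norm, h1, norm_smul, Real.norm_of_nonneg (by positivity), ← dist_eq_norm]
    gcongr
    linarith

/-- A family of open convex subsets of the unit ball, any two of which can be linked through a
third one along overlaps that contain a ball of radius `ρ`; two sets that do not themselves overlap
in such a ball are at distance at least `ρ`. -/
structure IsLinkedConvexFamily {ι : Type*} (U : ι → Set E) (ρ : ℝ) : Prop where
  convex : ∀ i, Convex ℝ (U i)
  isOpen : ∀ i, IsOpen (U i)
  subset_ball : ∀ i, U i ⊆ Metric.ball 0 1
  pos : 0 < ρ
  le_one : ρ ≤ 1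
  link : ∀ i j, ∃ k z w, Metric.ball z ρ ⊆ U i ∩ U k ∧ Metric.ball w ρ ⊆ U k ∩ U j ∧
    (k = i ∨ ∀ x ∈ U i, ∀ y ∈ U j, ρ ≤ dist x y)

namespace IsLinkedConvexFamily

variable {ι : Type*} {U : ι → Set E} {ρ : ℝ} (h : IsLinkedConvexFamily U ρ)

include h

theorem iUnion_subset_ball : ⋃ i, U i ⊆ Metric.ball 0 1 := iUnion_subset h.subset_ball

theorem exists_ball_subset [Finite ι] {x : E} (hx : x ∈ closure (⋃ i, U i)) {r : ℝ}
    (hr : 0 < r) :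
    ∃ w, Metric.ball w (ρ / 8 * min r 1) ⊆ (⋃ i, U i) ∩ Metric.ball x r := by
  rw [closure_iUnion_of_finite, mem_iUnion] at hx
  obtain ⟨i, hi⟩ := hx
  obtain ⟨k, z, w, hz, -⟩ := h.link i i
  obtain ⟨v, hv⟩ := (h.convex i).exists_ball_subset_inter_ball h.pos h.le_one
    (hz.trans inter_subset_left) (h.subset_ball i) hi hr
  exact ⟨v, hv.trans (inter_subset_inter_left _ (subset_iUnion U i))⟩

/-- Two pieces with a fat overlap that both come near x must also overlap near x, at the same scale
up to the factor 8/ρ. This is the source of the dilation constant in the Poincaré inequality. -/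
theorem exists_ball_subset_inter {i j : ι} {z : E} (hz : Metric.ball z ρ ⊆ U i ∩ U j) {x : E}
    {r : ℝ} (hi : (U i ∩ Metric.ball x r).Nonempty) (hj : (U j ∩ Metric.ball x r).Nonempty) :
    ∃ w, Metric.ball w (ρ / 8 * min r 1) ⊆ U i ∩ U j ∩ Metric.ball x (8 / ρ * r) := by
  obtain ⟨p, hp, hpx⟩ := hi
  obtain ⟨q, hq, hqx⟩ := hj
  rw [Metric.mem_ball] at hpx hqx
  have hr : 0 < r := dist_nonneg.trans_lt hpx
  have hρ := h.pos
  have hzp : dist z p ≤ 2 := by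
    have h1 := mem_ball_zero_iff.1 (h.subset_ball i (hz (Metric.mem_ball_self hρ)).1)
    have h2 := mem_ball_zero_iff.1 (h.subset_ball i hp)
    rw [dist_eq_norm]; linarith [norm_sub_le z p]
  obtain ⟨w, hw, hwp⟩ := (h.convex i).exists_mem_inter_dist_le (h.convex j) hρ hz hp hq
    (δ := 2 * r) (by linarith [dist_triangle_right p q x])
  obtain ⟨v, hv⟩ := ((h.convex i).inter (h.convex j)).exists_ball_subset_inter_ball hρ h.le_one hz
    (inter_subset_left.trans (h.subset_ball i)) (subset_closure hw) hr
  refine ⟨v, hv.trans (inter_subset_inter_right _ (Metric.ball_subset_ball' ?_))⟩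
  have h1 : dist w p ≤ 4 / ρ * r := by
    calc dist w p ≤ 2 * r / ρ * dist z p := hwp
      _ ≤ 2 * r / ρ * 2 := by gcongr
      _ = 4 / ρ * r := by ring
  have h2 : 1 ≤ 1 / ρ := by rw [le_div_iff₀ hρ]; linarith [h.le_one]
  have h3 : 8 / ρ * r = 4 / ρ * r + 4 * (1 / ρ) * r := by ring
  have h4 := dist_triangle w p x
  nlinarith

theorem subset_ball_of_le [Finite ι] {x : E} (hx : x ∈ closure (⋃ i, U i)) {R : ℝ}
    (hR : 2 ≤ R) : ⋃ i, U i ⊆ Metric.ball x R := by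
  intro y hy
  have h1 := mem_ball_zero_iff.1 (h.iUnion_subset_ball hy)
  have h2 := mem_closedBall_zero_iff.1
    (closure_minimal (h.iUnion_subset_ball.trans Metric.ball_subset_closedBall)
      Metric.isClosed_closedBall hx)
  rw [Metric.mem_ball, dist_eq_norm]
  linarith [norm_sub_le y x]

/-- Any two members that meet a ball are linked, at the scale of the ball, through a third one. -/
theorem exists_link [Finite ι] {i j : ι} {x : E} (hx : x ∈ closure (⋃ i, U i)) {r : ℝ}
    (hi : (U i ∩ Metric.ball x r).Nonempty) (hj : (U j ∩ Metric.ball x r).Nonempty) :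
    ∃ k w₁ w₂, Metric.ball w₁ (ρ / 8 * min r 1) ⊆ U i ∩ U k ∩ Metric.ball x (8 / ρ * r) ∧
      Metric.ball w₂ (ρ / 8 * min r 1) ⊆ U k ∩ U j ∩ Metric.ball x (8 / ρ * r) := by
  obtain ⟨k, z, w, hz, hw, rfl | hfar⟩ := h.link i j
  · obtain ⟨w₁, h₁⟩ := h.exists_ball_subset_inter hz hi hi
    obtain ⟨w₂, h₂⟩ := h.exists_ball_subset_inter hw hi hj
    exact ⟨k, w₁, w₂, h₁, h₂⟩
  · obtain ⟨p, hp, hpx⟩ := hi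
    obtain ⟨q, hq, hqx⟩ := hj
    rw [Metric.mem_ball] at hpx hqx
    have hρ := h.pos
    -- Separated pieces meet a common ball only at large radii, where the dilated ball contains the
    -- whole union and the linking balls need not be localized.
    have h1 : ρ < 2 * r := by linarith [dist_triangle_right p q x, hfar p hp q hq]
    have h2 : 2 ≤ 8 / ρ * r := by
      rw [div_mul_eq_mul_div, le_div_iff₀ hρ]; linarith
    have hball := h.subset_ball_of_le hx h2
    have hsm : ρ / 8 * min r 1 ≤ ρ := by
      nlinarith [min_le_right r 1]
    refine ⟨k, z, w, fun y hy => ?_, fun y hy => ?_⟩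
    · have := hz (Metric.ball_subset_ball hsm hy)
      exact ⟨this, hball (mem_iUnion_of_mem _ this.1)⟩
    · have := hw (Metric.ball_subset_ball hsm hy)
      exact ⟨this, hball (mem_iUnion_of_mem _ this.1)⟩

variable [MeasurableSpace E] [BorelSpace E] [FiniteDimensional ℝ E] (μ : Measure E)
  [μ.IsAddHaarMeasure]

open Module

omit [BorelSpace E] in
theorem measure_iUnion_ne_top : μ (⋃ i, U i) ≠ ∞ :=
  ((measure_mono h.iUnion_subset_ball).trans_lt measure_ball_lt_top).ne

/-- The ratio of the radii is (8/ρ)/(ρ/8) = 64/ρ². Truncation at radius 1 is harmless because the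
union lies in the unit ball. -/
theorem measure_inter_ball_le {x w : E} {r : ℝ} (hr : 0 < r) :
    μ ((⋃ i, U i) ∩ Metric.ball x (8 / ρ * r)) ≤
      ENNReal.ofReal ((64 / ρ ^ 2) ^ finrank ℝ E) * μ (Metric.ball w (ρ / 8 * min r 1)) := by
  have hρ := h.pos
  have hm : 0 < min r 1 := lt_min hr one_pos
  have h1 : 1 ≤ 8 / ρ := by rw [le_div_iff₀ hρ]; linarith [h.le_one]
  have key : μ ((⋃ i, U i) ∩ Metric.ball x (8 / ρ * r)) ≤
      ENNReal.ofReal ((8 / ρ * min r 1) ^ finrank ℝ E) * μ (Metric.ball 0 1) := by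
    rcases le_total r 1 with hr1 | hr1
    · rw [min_eq_left hr1, ← Measure.addHaar_ball_of_pos μ x (by positivity)]
      exact measure_mono inter_subset_right
    · rw [min_eq_right hr1, mul_one]
      refine (measure_mono (inter_subset_left.trans h.iUnion_subset_ball)).trans ?_
      refine le_mul_of_one_le_left' ?_
      rw [ENNReal.one_le_ofReal]
      exact one_le_pow₀ h1
  refine key.trans_eq ?_
  rw [Measure.addHaar_ball_of_pos μ w (by positivity), ← mul_assoc,
    ← ENNReal.ofReal_mul (by positivity), ← mul_pow]
  congr 3
  field_simp
  norm_num

/-- The chain runs from U i to `W₁` in U i ∩ U k, then to `W₂` in U k ∩ U j, then to U j. Each link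
lies in one convex piece, where the oscillation is at most `e`, and dividing by the measure of a
linking ball costs the factor κ. -/
theorem doubleOsc_inter_le [Finite ι] {x : E} (hx : x ∈ closure (⋃ i, U i)) {r : ℝ} (hr : 0 < r)
    {g : E → ℝ} {K : ℝ≥0} (hg : LipschitzWith K g) (i j : ι) :
    doubleOsc μ g (U i ∩ Metric.ball x r) (U j ∩ Metric.ball x r) ≤
      (2 * ENNReal.ofReal ((64 / ρ ^ 2) ^ finrank ℝ E) + 1) *
      ENNReal.ofReal ((64 / ρ ^ 2) ^ finrank ℝ E) *
      (2 * 2 ^ finrank ℝ E * ENNReal.ofReal (16 / ρ * r)) *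
      μ ((⋃ i, U i) ∩ Metric.ball x r) *
      ∫⁻ y in (⋃ i, U i) ∩ Metric.ball x (8 / ρ * r), ‖fderiv ℝ g y‖ₑ ∂μ := by
  rcases (U i ∩ Metric.ball x r).eq_empty_or_nonempty with hi | hi
  · simp [hi, doubleOsc]
  rcases (U j ∩ Metric.ball x r).eq_empty_or_nonempty with hj | hj
  · simp [hj, doubleOsc]
  obtain ⟨k, w₁, w₂, h₁, h₂⟩ := h.exists_link hx hi hj
  have hρ := h.pos
  have hgm : Measurable g := hg.continuous.measurable
  set V := Metric.ball x (8 / ρ * r) with hV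
  set Ω := ⋃ i, U i with hΩ
  set κ := ENNReal.ofReal ((64 / ρ ^ 2) ^ finrank ℝ E) with hκ
  set I := ∫⁻ y in Ω ∩ V, ‖fderiv ℝ g y‖ₑ ∂μ with hI
  set W₁ := Metric.ball w₁ (ρ / 8 * min r 1) with hW₁
  set W₂ := Metric.ball w₂ (ρ / 8 * min r 1) with hW₂
  have hBV : Metric.ball x r ⊆ V := by
    refine Metric.ball_subset_ball (le_mul_of_one_le_left hr.le ?_)
    rw [le_div_iff₀ hρ]; linarith [h.le_one]
  have hm : 0 < ρ / 8 * min r 1 := mul_pos (by positivity) (lt_min hr one_pos)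
  have hκ₁ : μ (Ω ∩ V) ≤ κ * μ W₁ := h.measure_inter_ball_le μ hr
  have hκ₂ : μ (Ω ∩ V) ≤ κ * μ W₂ := h.measure_inter_ball_le μ hr
  have hp₁ : μ W₁ ≠ 0 := (Metric.measure_ball_pos μ w₁ hm).ne'
  have hp₂ : μ W₂ ≠ 0 := (Metric.measure_ball_pos μ w₂ hm).ne'
  have ht₁ : μ W₁ ≠ ∞ := measure_ball_lt_top.ne
  have ht₂ : μ W₂ ≠ ∞ := measure_ball_lt_top.ne
  set e := 2 * 2 ^ finrank ℝ E * ENNReal.ofReal (16 / ρ * r) * μ (Ω ∩ V) * I with he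
  have hUe : ∀ i, doubleOsc μ g (U i ∩ V) (U i ∩ V) ≤ e := fun i => by
    refine (((h.convex i).inter (convex_ball x _)).doubleOsc_le μ
      ((h.isOpen i).inter Metric.isOpen_ball).measurableSet (D := ENNReal.ofReal (16 / ρ * r))
      (fun y hy z hz => ?_) hg).trans ?_
    · rw [edist_dist]
      refine ENNReal.ofReal_le_ofReal ?_
      have h3 := Metric.mem_ball.1 hy.2
      have h4 := Metric.mem_ball.1 hz.2
      have h5 : 16 / ρ * r = 8 / ρ * r + 8 / ρ * r := by ring
      linarith [dist_triangle_right y z x]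
    · have hsub : U i ∩ V ⊆ Ω ∩ V := inter_subset_inter_left _ (subset_iUnion U i)
      exact mul_le_mul' (mul_le_mul' le_rfl (measure_mono hsub)) (lintegral_mono_set hsub)
  have hW₁i : W₁ ⊆ U i ∩ V := fun y hy => ⟨(h₁ hy).1.1, (h₁ hy).2⟩
  have hW₁k : W₁ ⊆ U k ∩ V := fun y hy => ⟨(h₁ hy).1.2, (h₁ hy).2⟩
  have hW₂k : W₂ ⊆ U k ∩ V := fun y hy => ⟨(h₂ hy).1.1, (h₂ hy).2⟩
  have hW₂j : W₂ ⊆ U j ∩ V := fun y hy => ⟨(h₂ hy).1.2, (h₂ hy).2⟩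
  have hi' : U i ∩ Metric.ball x r ⊆ U i ∩ V := inter_subset_inter_right _ hBV
  have hj' : U j ∩ Metric.ball x r ⊆ U j ∩ V := inter_subset_inter_right _ hBV
  have hΩi : U i ∩ V ⊆ Ω ∩ V := inter_subset_inter_left _ (subset_iUnion U i)
  have hΩk : U k ∩ V ⊆ Ω ∩ V := inter_subset_inter_left _ (subset_iUnion U k)
  have step1 : doubleOsc μ g (U i ∩ Metric.ball x r) W₂ ≤ 2 * κ * e := by
    have := doubleOsc_mul_le μ hgm (U i ∩ Metric.ball x r) W₂ W₁
    refine (ENNReal.mul_le_mul_iff_left hp₁ ht₁).1 (this.trans ?_)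
    calc μ W₂ * doubleOsc μ g (U i ∩ Metric.ball x r) W₁ +
          μ (U i ∩ Metric.ball x r) * doubleOsc μ g W₁ W₂
        ≤ κ * μ W₁ * e + κ * μ W₁ * e := by
          gcongr
          · exact (measure_mono (hW₂k.trans hΩk)).trans hκ₁
          · exact (doubleOsc_mono μ g hi' hW₁i).trans (hUe i)
          · exact (measure_mono (hi'.trans hΩi)).trans hκ₁
          · exact (doubleOsc_mono μ g hW₁k hW₂k).trans (hUe k)
      _ = 2 * κ * e * μ W₁ := by ring
  have := doubleOsc_mul_le μ hgm (U i ∩ Metric.ball x r) (U j ∩ Metric.ball x r) W₂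
  refine (ENNReal.mul_le_mul_iff_left hp₂ ht₂).1 (this.trans ?_)
  -- One factor keeps the undilated ball, so that it cancels against the total mass in `poincare`;
  -- the factor μ (Ω ∩ V) inside `e` is traded for μ W₂.
  calc _ ≤ μ (Ω ∩ Metric.ball x r) * (2 * κ * e) + μ (Ω ∩ Metric.ball x r) * e := by
        gcongr
        · exact subset_iUnion U j
        · exact subset_iUnion U i
        · exact (doubleOsc_mono μ g hW₂j hj').trans (hUe j)
    _ = (2 * κ + 1) * (2 * 2 ^ finrank ℝ E * ENNReal.ofReal (16 / ρ * r)) *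
        μ (Ω ∩ Metric.ball x r) * I * μ (Ω ∩ V) := by rw [he]; ring
    _ ≤ (2 * κ + 1) * (2 * 2 ^ finrank ℝ E * ENNReal.ofReal (16 / ρ * r)) *
        μ (Ω ∩ Metric.ball x r) * I * (κ * μ W₂) := by gcongr
    _ = _ := by ring

theorem poincare [Finite ι] :
    ∃ C : ℝ, 0 < C ∧ ∀ x ∈ closure (⋃ i, U i), ∀ r : ℝ, 0 < r → ∀ g : E → ℝ,
      (∃ K : ℝ≥0, LipschitzWith K g) →
      ⨍ y in Metric.ball x r,
        |g y - ⨍ z in Metric.ball x r, g z ∂(μ.restrict (⋃ i, U i))| ∂(μ.restrict (⋃ i, U i)) ≤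
      C * r * √(⨍ y in Metric.ball x (8 / ρ * r), ‖fderiv ℝ g y‖ ^ 2
        ∂(μ.restrict (⋃ i, U i))) := by
  have : Fintype ι := Fintype.ofFinite ι
  have hρ := h.pos
  set Ω := ⋃ i, U i with hΩ
  set k : ℝ := (64 / ρ ^ 2) ^ finrank ℝ E with hk
  have hk0 : 0 < k := by positivity
  set c : ℝ := (Fintype.card ι) ^ 2 * ((2 * k + 1) * k * (2 * 2 ^ finrank ℝ E * (16 / ρ))) with hc
  have hc0 : 0 ≤ c := by positivity
  -- Here c counts pairs of pieces and k is the volume ratio of the two balls. The summand 1 only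
  -- secures positivity, since c = 0 for an empty family.
  refine ⟨c * k + 1, by positivity, ?_⟩
  rintro x hx r hr g ⟨K, hg⟩
  have hgm : Measurable g := hg.continuous.measurable
  have hhm : Measurable fun y => ‖fderiv ℝ g y‖ := (measurable_fderiv ℝ g).norm
  have hhb : ∀ y, ‖fderiv ℝ g y‖ ≤ K := fun y => norm_fderiv_le_of_lipschitz ℝ hg
  rw [Measure.restrict_restrict Metric.isOpen_ball.measurableSet,
    Measure.restrict_restrict Metric.isOpen_ball.measurableSet, inter_comm _ Ω, inter_comm _ Ω]
  set B := Metric.ball x r with hB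
  set V := Metric.ball x (8 / ρ * r) with hV
  set m := μ.restrict (Ω ∩ B) with hm
  set m' := μ.restrict (Ω ∩ V) with hm'
  have hfin : ∀ S, μ (Ω ∩ S) < ∞ := fun S =>
    (measure_mono inter_subset_left).trans_lt (h.measure_iUnion_ne_top μ).lt_top
  have : IsFiniteMeasure m := ⟨by simpa [hm] using hfin B⟩
  have : IsFiniteMeasure m' := ⟨by simpa [hm'] using hfin V⟩
  obtain ⟨w, hw⟩ := h.exists_ball_subset hx hr
  have hpos : 0 < μ (Ω ∩ B) := (Metric.measure_ball_pos μ w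
    (mul_pos (by positivity) (lt_min hr one_pos))).trans_le (measure_mono hw)
  have hvk : μ (Ω ∩ V) ≤ ENNReal.ofReal k * μ (Ω ∩ B) :=
    (h.measure_inter_ball_le μ hr (w := w)).trans (mul_le_mul_right (measure_mono hw) _)
  have hI : Integrable (fun y => ‖fderiv ℝ g y‖) m' :=
    Integrable.of_bound hhm.aestronglyMeasurable K (ae_of_all _ fun y => by simpa using hhb y)
  have hI2 : Integrable (fun y => ‖fderiv ℝ g y‖ ^ 2) m' :=
    Integrable.of_bound (hhm.pow_const 2).aestronglyMeasurable (K ^ 2) (ae_of_all _ fun y => by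
      rw [norm_pow, norm_norm]; exact pow_le_pow_left₀ (norm_nonneg _) (hhb y) 2)
  have hgi : Integrable g m := by
    refine Integrable.of_bound hgm.aestronglyMeasurable (‖g x‖ + K * r) ?_
    filter_upwards [ae_restrict_mem₀ (((isOpen_iUnion h.isOpen).inter
      Metric.isOpen_ball).measurableSet.nullMeasurableSet)] with y hy
    have h1 := hg.dist_le_mul y x
    have h2 : dist y x ≤ r := (Metric.mem_ball.1 hy.2).le
    have h3 : ‖g y‖ ≤ ‖g x‖ + ‖g y - g x‖ := by
      simpa using norm_add_le (g x) (g y - g x)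
    rw [dist_eq_norm] at h1
    have h4 : (K : ℝ) * dist y x ≤ K * r := by gcongr
    linarith
  have hosc : μ (Ω ∩ B) * ∫⁻ y, ‖g y - ⨍ z, g z ∂m‖ₑ ∂m ≤
      μ (Ω ∩ B) * (ENNReal.ofReal (c * r) * ∫⁻ y, ‖fderiv ℝ g y‖ₑ ∂m') := by
    have h1 := measure_univ_mul_lintegral_sub_average_le m hgi
    rw [hm, Measure.restrict_apply_univ] at h1
    refine h1.trans ?_
    change doubleOsc μ g (Ω ∩ B) (Ω ∩ B) ≤ _
    have h2 : Ω ∩ B = ⋃ i, U i ∩ B := iUnion_inter _ _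
    have h3 := doubleOsc_iUnion_le μ hgm (fun i => U i ∩ B)
    rw [← h2] at h3
    refine h3.trans ((Finset.sum_le_sum fun i _ => Finset.sum_le_sum fun j _ =>
      h.doubleOsc_inter_le μ hx hr hg i j).trans_eq ?_)
    have h4 : ENNReal.ofReal (c * r) = (Fintype.card ι) ^ 2 * ((2 * ENNReal.ofReal k + 1) *
        ENNReal.ofReal k * (2 * 2 ^ finrank ℝ E * ENNReal.ofReal (16 / ρ * r))) := by
      rw [show c * r = (Fintype.card ι) ^ 2 * ((2 * k + 1) * k *
        (2 * 2 ^ finrank ℝ E * (16 / ρ * r))) by rw [hc]; ring]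
      rw [ENNReal.ofReal_mul (by positivity), ENNReal.ofReal_mul (by positivity),
        ENNReal.ofReal_mul (by positivity), ENNReal.ofReal_add (by positivity) zero_le_one,
        ENNReal.ofReal_mul zero_le_two, ENNReal.ofReal_mul (p := 2 * 2 ^ _) (by positivity),
        ENNReal.ofReal_mul zero_le_two]
      simp [ENNReal.ofReal_pow]
    rw [h4]
    simp only [Finset.sum_const, Finset.card_univ, nsmul_eq_mul]
    ring
  have hosc' := (ENNReal.mul_le_mul_iff_right hpos.ne' (hfin B).ne).1 hosc
  have hreal : ∫ y, |g y - ⨍ z, g z ∂m| ∂m ≤ c * r * ∫ y, ‖fderiv ℝ g y‖ ∂m' := by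
    have h1 : ENNReal.ofReal (∫ y, |g y - ⨍ z, g z ∂m| ∂m) ≤
        ENNReal.ofReal (c * r * ∫ y, ‖fderiv ℝ g y‖ ∂m') := by
      rw [ENNReal.ofReal_mul (by positivity)]
      have h2 := ofReal_integral_norm_eq_lintegral_enorm (hgi.sub (integrable_const (⨍ z, g z ∂m)))
      have h3 := ofReal_integral_norm_eq_lintegral_enorm hI
      simp only [enorm_norm, norm_norm] at h3
      simp only [Pi.sub_apply, Real.norm_eq_abs] at h2
      rw [h2, h3]
      exact hosc'
    rwa [ENNReal.ofReal_le_ofReal_iff (by positivity)] at h1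
  have hN : 0 < m.real univ := by
    rw [Measure.real, ENNReal.toReal_pos_iff, hm, Measure.restrict_apply_univ]
    exact ⟨hpos, hfin B⟩
  have hvN : m'.real univ ≤ k * m.real univ := by
    rw [Measure.real, Measure.real, hm, hm', Measure.restrict_apply_univ,
      Measure.restrict_apply_univ]
    have := ENNReal.toReal_mono (ENNReal.mul_ne_top ENNReal.ofReal_ne_top (hfin B).ne) hvk
    rwa [ENNReal.toReal_mul, ENNReal.toReal_ofReal hk0.le] at this
  have havg : ∫ y, ‖fderiv ℝ g y‖ ∂m' = m'.real univ * ⨍ y, ‖fderiv ℝ g y‖ ∂m' := by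
    rw [← smul_eq_mul, measure_smul_average]
  have hJ := average_le_sqrt_average_sq m' hI hI2
  set J := √(⨍ y, ‖fderiv ℝ g y‖ ^ 2 ∂m') with hJdef
  have hJ0 : 0 ≤ J := Real.sqrt_nonneg _
  rw [average_eq, smul_eq_mul, inv_mul_le_iff₀ hN]
  calc _ ≤ c * r * (m'.real univ * ⨍ y, ‖fderiv ℝ g y‖ ∂m') := havg ▸ hreal
    _ ≤ c * r * (m'.real univ * J) := by gcongr
    _ ≤ c * r * (k * m.real univ * J) := by gcongr
    _ ≤ m.real univ * ((c * k + 1) * r * J) := by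
      have : 0 ≤ m.real univ * r * J := by positivity
      nlinarith

theorem exists_ahlfors [Finite ι] :
    ∃ C : ℝ, 1 ≤ C ∧ ∀ x ∈ closure (⋃ i, U i), ∀ r : ℝ, 0 < r → r ≤ 1 →
      ENNReal.ofReal (C⁻¹ * r ^ finrank ℝ E) ≤ μ.restrict (⋃ i, U i) (Metric.ball x r) ∧
      μ.restrict (⋃ i, U i) (Metric.ball x r) ≤ ENNReal.ofReal (C * r ^ finrank ℝ E) := by
  have hρ := h.pos
  set b := μ.real (Metric.ball (0 : E) 1) with hb
  have hbμ : μ (Metric.ball (0 : E) 1) = ENNReal.ofReal b := by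
    rw [hb, Measure.real, ENNReal.ofReal_toReal measure_ball_lt_top.ne]
  have hb0 : 0 < b := ENNReal.toReal_pos (Metric.measure_ball_pos μ 0 one_pos).ne'
    measure_ball_lt_top.ne
  set a := (ρ / 8) ^ finrank ℝ E * b with ha
  have ha0 : 0 < a := by positivity
  refine ⟨max 1 (max b a⁻¹), le_max_left _ _, fun x hx r hr hr1 => ?_⟩
  rw [Measure.restrict_apply Metric.isOpen_ball.measurableSet, inter_comm]
  constructor
  · obtain ⟨w, hw⟩ := h.exists_ball_subset hx hr
    refine le_trans ?_ (measure_mono hw)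
    rw [Measure.addHaar_ball_of_pos μ w (mul_pos (by positivity) (lt_min hr one_pos)), hbμ,
      ← ENNReal.ofReal_mul (by positivity), min_eq_left hr1]
    refine ENNReal.ofReal_le_ofReal ?_
    rw [mul_pow, mul_right_comm, ← ha]
    gcongr
    rw [inv_le_comm₀ (by positivity) ha0]
    exact (le_max_right _ _).trans (le_max_right _ _)
  · refine (measure_mono inter_subset_right).trans ?_
    rw [Measure.addHaar_ball_of_pos μ x hr, hbμ, ← ENNReal.ofReal_mul (by positivity), mul_comm]
    refine ENNReal.ofReal_le_ofReal ?_
    gcongr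
    exact (le_max_left _ _).trans (le_max_right _ _)

end IsLinkedConvexFamily

end ConvexCover

/-! ### The ball minus the cube as a linked convex family -/

section SmallCube

/-- The part of the open unit ball of `ℝⁿ` beyond the face of `smallCube n` in direction `i` with
sign `s`. -/
def beyondFace (n : ℕ) (p : Fin n × ℤˣ) : Set (EuclideanSpace ℝ (Fin n)) :=
  Metric.ball 0 1 ∩
    {x | 1 / 20 < ((p.2 : ℤ) : ℝ) * (x p.1 - (if (p.1 : ℕ) = 0 then 1 / 2 else 0))}

theorem iUnion_beyondFace (n : ℕ) : ⋃ p, beyondFace n p = Metric.ball 0 1 \ smallCube n := by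
  ext x
  simp only [mem_iUnion, beyondFace, mem_inter_iff, mem_ofPred_eq, Set.mem_sdiff, smallCube, not_forall,
    not_le, Prod.exists]
  constructor
  · rintro ⟨i, s, hx, h⟩
    refine ⟨hx, i, ?_⟩
    rcases Int.units_eq_one_or s with rfl | rfl
    · exact lt_abs.2 (Or.inl (by simpa using h))
    · exact lt_abs.2 (Or.inr (by simpa using h))
  · rintro ⟨hx, i, h⟩
    rcases lt_abs.1 h with h | h
    · exact ⟨i, 1, hx, by simpa using h⟩
    · exact ⟨i, -1, hx, by simpa using h⟩

/-- The centre of the cube is shifted by 3/50 along two different axes. Since 3/50 - 1/200 > 1/20, a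
ball of radius 1/200 clears both faces, and 31/50 + 1/200 < 1 keeps it in the unit ball. -/
theorem exists_ball_subset_beyondFace_inter (n : ℕ) (hn : 0 < n) {i j : Fin n} (hij : i ≠ j)
    (s t : ℤˣ) : ∃ z, Metric.ball z (1 / 200) ⊆ beyondFace n (i, s) ∩ beyondFace n (j, t) := by
  have hs : ∀ u : ℤˣ, ((u : ℤ) : ℝ) * ((u : ℤ) : ℝ) = 1 := fun u => by
    rcases Int.units_eq_one_or u with rfl | rfl <;> simp
  have ha : ∀ u : ℤˣ, |((u : ℤ) : ℝ)| = 1 := fun u => by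
    rcases Int.units_eq_one_or u with rfl | rfl <;> simp
  set z : EuclideanSpace ℝ (Fin n) := EuclideanSpace.single ⟨0, hn⟩ (1 / 2) +
    (EuclideanSpace.single i (((s : ℤ) : ℝ) * (3 / 50)) +
      EuclideanSpace.single j (((t : ℤ) : ℝ) * (3 / 50))) with hz
  have hc : ∀ k : Fin n, (EuclideanSpace.single (⟨0, hn⟩ : Fin n) (1 / 2 : ℝ)) k =
      if (k : ℕ) = 0 then 1 / 2 else 0 := fun k => by
    rw [PiLp.single_apply]
    simp [Fin.ext_iff]
  have hzn : ‖z‖ ≤ 31 / 50 := by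
    have h1 := norm_add_le (EuclideanSpace.single (⟨0, hn⟩ : Fin n) (1 / 2 : ℝ))
      (EuclideanSpace.single i (((s : ℤ) : ℝ) * (3 / 50)) +
      EuclideanSpace.single j (((t : ℤ) : ℝ) * (3 / 50)))
    have h2 := norm_add_le (EuclideanSpace.single i (((s : ℤ) : ℝ) * (3 / 50)))
      (EuclideanSpace.single j (((t : ℤ) : ℝ) * (3 / 50)))
    rw [PiLp.norm_single] at h1
    simp only [PiLp.norm_single, norm_mul, Real.norm_eq_abs, ha] at h2
    norm_num at h1 h2
    rw [hz]; norm_num; linarith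
  have key : ∀ y ∈ Metric.ball z (1 / 200), ∀ (k : Fin n) (u : ℤˣ),
      z k - (if (k : ℕ) = 0 then 1 / 2 else 0) = ((u : ℤ) : ℝ) * (3 / 50) →
      y ∈ beyondFace n (k, u) := by
    intro y hy k u hk
    rw [Metric.mem_ball, dist_eq_norm] at hy
    refine ⟨?_, ?_⟩
    · rw [mem_ball_zero_iff]
      linarith [norm_le_norm_add_norm_sub' y z]
    · have h1 : |y k - z k| < 1 / 200 := (PiLp.norm_apply_le (y - z) k).trans_lt hy
      have h2 : |((u : ℤ) : ℝ) * (y k - z k)| < 1 / 200 := by rwa [abs_mul, ha, one_mul]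
      have h3 : ((u : ℤ) : ℝ) * (y k - (if (k : ℕ) = 0 then 1 / 2 else 0)) =
          ((u : ℤ) : ℝ) * (y k - z k) + 3 / 50 := by
        rw [show y k - (if (k : ℕ) = 0 then 1 / 2 else 0) = (y k - z k) +
          (z k - (if (k : ℕ) = 0 then 1 / 2 else 0)) by ring, hk, mul_add, ← mul_assoc, hs]
        ring
      rw [mem_ofPred_eq, h3]
      linarith [(abs_lt.1 h2).1]
  refine ⟨z, fun y hy => ⟨key y hy i s ?_, key y hy j t ?_⟩⟩
  · rw [hz, PiLp.add_apply, PiLp.add_apply, hc, PiLp.single_apply, PiLp.single_apply, if_pos rfl,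
      if_neg hij]
    ring
  · rw [hz, PiLp.add_apply, PiLp.add_apply, hc, PiLp.single_apply, PiLp.single_apply, if_pos rfl,
      if_neg hij.symm]
    ring

theorem isLinkedConvexFamily_beyondFace (n : ℕ) (hn : 2 ≤ n) :
    IsLinkedConvexFamily (beyondFace n) (1 / 200) where
  convex p := by
    refine (convex_ball _ _).inter ?_
    intro x hx y hy a b ha hb hab
    simp only [mem_ofPred_eq, PiLp.add_apply, PiLp.smul_apply, smul_eq_mul] at *
    set c : ℝ := if (p.1 : ℕ) = 0 then 1 / 2 else 0
    have : ((p.2 : ℤ) : ℝ) * (a * x p.1 + b * y p.1 - c) =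
        a * (((p.2 : ℤ) : ℝ) * (x p.1 - c)) + b * (((p.2 : ℤ) : ℝ) * (y p.1 - c)) := by
      linear_combination ((p.2 : ℤ) : ℝ) * c * hab
    rw [this]
    exact (convex_Ioi (1 / 20 : ℝ)) hx hy ha hb hab
  isOpen p := by
    refine Metric.isOpen_ball.inter (isOpen_lt continuous_const ?_)
    fun_prop
  subset_ball p := inter_subset_left
  pos := by norm_num
  le_one := by norm_num
  link := by
    rintro ⟨i, s⟩ ⟨j, t⟩
    have hn0 : 0 < n := by omega
    have : Nontrivial (Fin n) := Fin.nontrivial_iff_two_le.2 hn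
    by_cases hij : i = j
    · subst hij
      obtain ⟨l, hl⟩ := exists_ne i
      by_cases hst : s = t
      · subst hst
        obtain ⟨z, hz⟩ := exists_ball_subset_beyondFace_inter n hn0 hl.symm s 1
        have hz' := hz.trans inter_subset_left
        exact ⟨(i, s), z, z, subset_inter hz' hz', subset_inter hz' hz', Or.inl rfl⟩
      · obtain ⟨z, hz⟩ := exists_ball_subset_beyondFace_inter n hn0 hl.symm s 1
        obtain ⟨w, hw⟩ := exists_ball_subset_beyondFace_inter n hn0 hl 1 t
        -- Opposite faces: the link goes through a piece in another direction l, and the i-th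
        -- coordinates differ by more than the side 1/10 of the cube.
        refine ⟨(l, 1), z, w, hz, hw, Or.inr fun x hx y hy => ?_⟩
        have h1 : |x i - y i| ≤ dist x y := by
          rw [dist_eq_norm]; exact PiLp.norm_apply_le (x - y) i
        have hx2 := hx.2
        have hy2 := hy.2
        simp only [mem_ofPred_eq] at hx2 hy2
        refine le_trans ?_ h1
        rcases Int.units_eq_one_or s with rfl | rfl <;>
          rcases Int.units_eq_one_or t with rfl | rfl
        · exact absurd rfl hst
        · refine le_trans ?_ (le_abs_self _)
          push_cast at hx2 hy2
          linarith
        · refine le_trans ?_ (neg_le_abs _)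
          push_cast at hx2 hy2
          linarith
        · exact absurd rfl hst
    · obtain ⟨z, hz⟩ := exists_ball_subset_beyondFace_inter n hn0 hij s t
      have hz' := hz.trans inter_subset_left
      exact ⟨(i, s), z, z, subset_inter hz' hz', hz, Or.inl rfl⟩

/-- The frontier of a convex set is null, and the closure of a finite union is the union of the
closures. -/
theorem closure_ball_diff_smallCube_ae_eq (n : ℕ) (hn : 2 ≤ n) :
    closure (Metric.ball 0 1 \ smallCube n) =ᵐ[volume]
      (Metric.ball 0 1 \ smallCube n : Set (EuclideanSpace ℝ (Fin n))) := by
  rw [← iUnion_beyondFace, closure_iUnion_of_finite]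
  have h := isLinkedConvexFamily_beyondFace n hn
  exact Filter.EventuallyEq.countable_iUnion fun p =>
    closure_ae_eq_of_null_frontier ((h.convex p).addHaar_frontier volume)

theorem isOpen_ball_diff_smallCube (n : ℕ) (hn : 2 ≤ n) :
    IsOpen (Metric.ball 0 1 \ smallCube n) := by
  rw [← iUnion_beyondFace]
  exact isOpen_iUnion (isLinkedConvexFamily_beyondFace n hn).isOpen

theorem exists_le_abs_of_mem_closure {n : ℕ} {w : EuclideanSpace ℝ (Fin n)}
    (hw : w ∈ closure (Metric.ball 0 1 \ smallCube n)) :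
    ∃ i : Fin n, 1 / 20 ≤ |w i - (if (i : ℕ) = 0 then 1 / 2 else 0)| := by
  have hcl : IsClosed (⋃ i : Fin n, {w : EuclideanSpace ℝ (Fin n) |
      1 / 20 ≤ |w i - (if (i : ℕ) = 0 then 1 / 2 else 0)|}) :=
    isClosed_iUnion_of_finite fun i => isClosed_le continuous_const (by fun_prop)
  refine mem_iUnion.1 (closure_minimal (fun x hx => ?_) hcl hw)
  have := hx.2
  simp only [smallCube, mem_ofPred_eq, not_forall, not_le] at this
  obtain ⟨i, hi⟩ := this
  exact mem_iUnion.2 ⟨i, hi.le⟩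

end SmallCube

/-! ### Transport of measures along the isometric embedding -/

section ZeroExtension

/-- The isometric embedding `x ↦ (x, 0)` of `ℝⁿ` into `ℝⁿ × ℝᵈ`. -/
noncomputable def zeroExtension (n d : ℕ) :
    EuclideanSpace ℝ (Fin n) →ₗᵢ[ℝ] EuclideanSpace ℝ (Fin (n + d)) where
  toFun x := WithLp.toLp 2 (Fin.append (fun i => x i) (fun _ : Fin d => (0 : ℝ)))
  map_add' x y := by
    ext k
    refine Fin.addCases (fun i => ?_) (fun i => ?_) k <;> simp
  map_smul' c x := by
    ext k
    refine Fin.addCases (fun i => ?_) (fun i => ?_) k <;> simp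
  norm_map' x := by
    simp [EuclideanSpace.norm_eq, Fin.sum_univ_add]

variable {n d : ℕ}

@[simp]
theorem zeroExtension_castAdd (x : EuclideanSpace ℝ (Fin n)) (i : Fin n) :
    zeroExtension n d x (Fin.castAdd d i) = x i := by
  simp [zeroExtension]

@[simp]
theorem zeroExtension_natAdd (x : EuclideanSpace ℝ (Fin n)) (i : Fin d) :
    zeroExtension n d x (Fin.natAdd n i) = 0 := by
  simp [zeroExtension]

theorem perforatedDisc_eq_image : perforatedDisc n d =
    zeroExtension n d '' closure (Metric.ball 0 1 \ smallCube n) := rfl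

theorem isCompact_closure_ball_diff_smallCube (n : ℕ) :
    IsCompact (closure (Metric.ball 0 1 \ smallCube n)) :=
  (Metric.isBounded_ball.subset sdiff_subset).isCompact_closure

theorem isCompact_perforatedDisc : IsCompact (perforatedDisc n d) :=
  (isCompact_closure_ball_diff_smallCube n).image (zeroExtension n d).continuous

theorem isClosedEmbedding_zeroExtension : IsClosedEmbedding (zeroExtension n d) :=
  (zeroExtension n d).isometry.isClosedEmbedding

theorem map_zeroExtension_volume :
    (volume : Measure (EuclideanSpace ℝ (Fin n))).map (zeroExtension n d) =
      μHE[n].restrict (range (zeroExtension n d)) := by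
  rw [← (zeroExtension n d).isometry.map_euclideanHausdorffMeasure,
    EuclideanSpace.euclideanHausdorffMeasure_eq_volume]

theorem restrict_perforatedDisc (hn : 2 ≤ n) :
    (μHE[n] : Measure (EuclideanSpace ℝ (Fin (n + d)))).restrict (perforatedDisc n d) =
      (volume.restrict (Metric.ball 0 1 \ smallCube n)).map (zeroExtension n d) := by
  have he : MeasurableEmbedding (zeroExtension n d) :=
    isClosedEmbedding_zeroExtension.measurableEmbedding
  rw [← Measure.restrict_congr_set (closure_ball_diff_smallCube_ae_eq n hn)]
  have h1 := he.restrict_map volume (perforatedDisc n d)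
  rw [map_zeroExtension_volume,
    Measure.restrict_restrict isCompact_perforatedDisc.measurableSet,
    perforatedDisc_eq_image, inter_eq_left.2 (image_subset_range _ _),
    preimage_image_eq _ (zeroExtension n d).injective] at h1
  rw [perforatedDisc_eq_image]
  exact h1

theorem restrict_perforatedDisc_restrict_ball (hn : 2 ≤ n) (z : EuclideanSpace ℝ (Fin n)) (r : ℝ) :
    ((μHE[n] : Measure (EuclideanSpace ℝ (Fin (n + d)))).restrict (perforatedDisc n d)).restrict
      (Metric.ball (zeroExtension n d z) r) =
      ((volume.restrict (Metric.ball 0 1 \ smallCube n)).restrict (Metric.ball z r)).map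
        (zeroExtension n d) := by
  rw [restrict_perforatedDisc hn, isClosedEmbedding_zeroExtension.measurableEmbedding.restrict_map,
    (zeroExtension n d).isometry.preimage_ball]

instance : IsFiniteMeasure (volume.restrict (Metric.ball 0 1 \ smallCube n)) :=
  ⟨by simpa using (measure_mono sdiff_subset).trans_lt measure_ball_lt_top⟩

theorem MeasurableEmbedding.average_map {X Y F : Type*} [MeasurableSpace X] [MeasurableSpace Y]
    [NormedAddCommGroup F] [NormedSpace ℝ F] {e : X → Y} (he : MeasurableEmbedding e)
    (m : Measure X) (f : Y → F) : ⨍ y, f y ∂(m.map e) = ⨍ x, f (e x) ∂m := by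
  rw [average_eq, average_eq, he.integral_map, Measure.real, Measure.real, he.map_apply,
    preimage_univ]

end ZeroExtension

/-! ### Approximate tangent spaces and tangential gradients -/

section ApproxTangentSpace

/-- A bump function at a vector of P outside Q, supported away from Q, has positive integral over P
and zero integral over Q, although both are the same blow-up limit. The resulting uniqueness
identifies the space picked by choice in `approxTangentSpace`. -/
theorem IsApproxTangentSpace.le {n N : ℕ} {M : Set (EuclideanSpace ℝ (Fin N))}
    {x : EuclideanSpace ℝ (Fin N)} {P Q : Submodule ℝ (EuclideanSpace ℝ (Fin N))}
    (hP : IsApproxTangentSpace n M x P) (hQ : IsApproxTangentSpace n M x Q) : P ≤ Q := by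
  intro v hv
  by_contra hvQ
  have hQo : IsOpen (Q : Set (EuclideanSpace ℝ (Fin N)))ᶜ :=
    Q.closed_of_finiteDimensional.isOpen_compl
  obtain ⟨ε, hε, hball⟩ := Metric.isOpen_iff.1 hQo v hvQ
  let f : ContDiffBump v := ⟨ε / 4, ε / 2, by positivity, by linarith⟩
  have h1 := (hP.2 f f.contDiff f.hasCompactSupport).2
  have h2 := (hQ.2 f f.contDiff f.hasCompactSupport).2
  have heq := tendsto_nhds_unique h1 h2
  have hQ0 : ∫ y in (Q : Set (EuclideanSpace ℝ (Fin N))), f y ∂μHE[n] = 0 := by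
    refine setIntegral_eq_zero_of_forall_eq_zero fun y hy => f.zero_of_le_dist ?_
    by_contra! hlt
    exact hball (Metric.mem_ball.2 (hlt.trans (half_lt_self hε))) hy
  rw [hQ0] at heq
  have hrange : (P : Set (EuclideanSpace ℝ (Fin N))) = range P.subtypeₗᵢ := by
    ext; simp
  have hcl : IsClosedEmbedding P.subtypeₗᵢ := P.subtypeₗᵢ.isometry.isClosedEmbedding
  rw [hrange, ← P.subtypeₗᵢ.isometry.map_euclideanHausdorffMeasure, hcl.measurableEmbedding.integral_map] at heq
  have hfin := hP.1
  subst hfin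
  have hpos : 0 < ∫ p : P, f p ∂(μHE[Module.finrank ℝ P] : Measure P) := by
    refine Continuous.integral_pos_of_hasCompactSupport_nonneg_nonzero (x := ⟨v, hv⟩)
      (f.continuous.comp continuous_subtype_val) (f.hasCompactSupport.comp_isClosedEmbedding hcl)
      (fun p => f.nonneg) ?_
    change f v ≠ 0
    rw [f.one_of_mem_closedBall (Metric.mem_closedBall_self (by positivity))]
    exact one_ne_zero
  exact hpos.ne' heq

theorem IsApproxTangentSpace.approxTangentSpace_eq {n N : ℕ} {M : Set (EuclideanSpace ℝ (Fin N))}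
    {x : EuclideanSpace ℝ (Fin N)} {P : Submodule ℝ (EuclideanSpace ℝ (Fin N))}
    (hP : IsApproxTangentSpace n M x P) : approxTangentSpace n M x = P := by
  have h : ∃ P, IsApproxTangentSpace n M x P := ⟨P, hP⟩
  rw [approxTangentSpace, dif_pos h]
  exact le_antisymm (h.choose_spec.le hP) (hP.le h.choose_spec)

variable {n d : ℕ}

theorem isApproxTangentSpace_perforatedDisc (hn : 2 ≤ n) {z : EuclideanSpace ℝ (Fin n)}
    (hz : z ∈ Metric.ball 0 1 \ smallCube n) :
    IsApproxTangentSpace n (perforatedDisc n d) (zeroExtension n d z)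
      (LinearMap.range (zeroExtension n d).toLinearMap) := by
  have he : MeasurableEmbedding (zeroExtension n d) :=
    isClosedEmbedding_zeroExtension.measurableEmbedding
  refine ⟨?_, fun f hf hfc => ?_⟩
  · rw [LinearMap.finrank_range_of_inj (zeroExtension n d).injective, finrank_euclideanSpace_fin]
  set Ω : Set (EuclideanSpace ℝ (Fin n)) := Metric.ball 0 1 \ smallCube n with hΩ
  have hfcont := hf.continuous
  constructor
  · refine Eventually.of_forall fun h => ?_
    obtain ⟨C, hC⟩ := hfc.exists_bound_of_continuous hfcont
    rw [IntegrableOn, restrict_perforatedDisc hn, he.integrable_map_iff]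
    refine Integrable.of_bound (Continuous.aestronglyMeasurable (by fun_prop)) C
      (ae_of_all _ fun w => hC _)
  · have hrange : ((LinearMap.range (zeroExtension n d).toLinearMap :
        Submodule ℝ (EuclideanSpace ℝ (Fin (n + d)))) : Set (EuclideanSpace ℝ (Fin (n + d)))) =
        range (zeroExtension n d) := by
      ext; simp
    rw [hrange, ← map_zeroExtension_volume, he.integral_map]
    refine tendsto_const_nhds.congr' ?_
    obtain ⟨ε, hε, hball⟩ := Metric.isOpen_iff.1 (isOpen_ball_diff_smallCube n hn) z hz
    obtain ⟨R, hR, hsupp⟩ := hfc.isCompact.isBounded.subset_ball_lt 0 0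
    -- For h < ε/R the rescaled test function is supported in the ε-ball about z, inside Ω. The
    -- integral over M is then one over the full plane, and scaling makes it exactly equal to the
    -- limit.
    filter_upwards [Ioo_mem_nhdsGT (show (0 : ℝ) < ε / R by positivity)] with h hh
    rw [restrict_perforatedDisc hn, he.integral_map]
    have hh0 : 0 < h := hh.1
    have h1 : ∀ w, h⁻¹ • (zeroExtension n d w - zeroExtension n d z) =
        zeroExtension n d (h⁻¹ • (w - z)) := fun w => by rw [map_smul, map_sub]
    simp_rw [h1]
    rw [setIntegral_eq_integral_of_forall_compl_eq_zero]
    · rw [integral_sub_right_eq_self (fun w => f (zeroExtension n d (h⁻¹ • w))) z,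
        Measure.integral_comp_inv_smul volume (fun w => f (zeroExtension n d w)),
        finrank_euclideanSpace_fin, abs_of_nonneg (by positivity), smul_eq_mul,
        inv_mul_cancel_left₀ (by positivity)]
    · intro w hw
      by_contra hne
      have h2 := hsupp (subset_tsupport f hne)
      rw [mem_ball_zero_iff, LinearIsometry.norm_map, norm_smul, norm_inv,
        Real.norm_of_nonneg hh0.le, inv_mul_lt_iff₀ hh0] at h2
      refine hw (hball ?_)
      rw [Metric.mem_ball, dist_eq_norm]
      have h3 := (lt_div_iff₀ hR).1 hh.2
      exact h2.trans h3

theorem approxTangentSpace_perforatedDisc (hn : 2 ≤ n) {z : EuclideanSpace ℝ (Fin n)}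
    (hz : z ∈ Metric.ball 0 1 \ smallCube n) :
    approxTangentSpace n (perforatedDisc n d) (zeroExtension n d z) =
      LinearMap.range (zeroExtension n d).toLinearMap :=
  (isApproxTangentSpace_perforatedDisc hn hz).approxTangentSpace_eq

/-- The norm of the gradient of `f` along the range of a linear isometry. -/
theorem norm_gradient_range {V W : Type*} [NormedAddCommGroup V] [InnerProductSpace ℝ V]
    [CompleteSpace V] [NormedAddCommGroup W] [InnerProductSpace ℝ W] (L : V →ₗᵢ[ℝ] W)
    [CompleteSpace (LinearMap.range L.toLinearMap)] (f : W → ℝ) (z : V) :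
    ‖gradient (fun v : LinearMap.range L.toLinearMap => f (L z + v)) 0‖ =
      ‖fderiv ℝ (f ∘ L) z‖ := by
  set e : V ≃ₗᵢ[ℝ] LinearMap.range L.toLinearMap := L.equivRange with he
  set F : LinearMap.range L.toLinearMap → ℝ := fun v => f (L z + v) with hF
  have h1 : (fun w => (F ∘ e) w) = fun w => (f ∘ L) (z + w) := by
    ext w
    simp only [hF, Function.comp, map_add]
    rfl
  have h2 : fderiv ℝ (F ∘ e) 0 = fderiv ℝ (f ∘ L) z := by
    change fderiv ℝ (fun w => (F ∘ e) w) 0 = _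
    rw [h1, fderiv_comp_add_left, add_zero]
  have h3 : fderiv ℝ (F ∘ e) 0 = (fderiv ℝ F 0).comp (e : V →L[ℝ] _) := by
    have := e.toContinuousLinearEquiv.comp_right_fderiv (f := F) (x := 0)
    simpa using this
  rw [gradient, LinearIsometryEquiv.norm_map, ← h2, h3]
  exact (ContinuousLinearMap.opNorm_comp_linearIsometryEquiv _ e).symm

theorem norm_tangentialGradient_perforatedDisc (hn : 2 ≤ n) {z : EuclideanSpace ℝ (Fin n)}
    (hz : z ∈ Metric.ball 0 1 \ smallCube n) (f : EuclideanSpace ℝ (Fin (n + d)) → ℝ) :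
    ‖tangentialGradient n (perforatedDisc n d) f (zeroExtension n d z)‖ =
      ‖fderiv ℝ (f ∘ zeroExtension n d) z‖ := by
  -- The gradient lives in a type depending on the tangent space, so the equality of subspaces is
  -- used by substitution for a variable T.
  have key : ∀ T : Submodule ℝ (EuclideanSpace ℝ (Fin (n + d))),
      T = LinearMap.range (zeroExtension n d).toLinearMap →
      ‖gradient (fun v : T => f (zeroExtension n d z + v)) 0‖ =
        ‖fderiv ℝ (f ∘ zeroExtension n d) z‖ := by
    rintro _ rfl
    exact norm_gradient_range _ f z
  exact key _ (approxTangentSpace_perforatedDisc hn hz)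

end ApproxTangentSpace

/-! ### The properties of the perforated disc -/

section PerforatedDisc

variable {n d : ℕ}

theorem isCountablyRectifiable_perforatedDisc :
    IsCountablyRectifiable n (perforatedDisc n d) := by
  refine ⟨le_toOuterMeasure_caratheodory _ _ isCompact_perforatedDisc.measurableSet, ∅,
    fun _ => closure (Metric.ball 0 1 \ smallCube n), fun _ => zeroExtension n d, measure_empty,
    fun _ => ⟨1, (zeroExtension n d).lipschitz.lipschitzOnWith⟩, ?_⟩
  rw [empty_union, perforatedDisc_eq_image]
  exact subset_iUnion (fun _ : ℕ => zeroExtension n d '' closure (Metric.ball 0 1 \ smallCube n)) 0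

theorem exists_isAhlforsRegular_perforatedDisc (hn : 2 ≤ n) :
    ∃ C : ℝ, 1 ≤ C ∧ IsAhlforsRegular n (perforatedDisc n d) C := by
  obtain ⟨C, hC, h⟩ := (isLinkedConvexFamily_beyondFace n hn).exists_ahlfors volume
  rw [iUnion_beyondFace, finrank_euclideanSpace_fin] at h
  refine ⟨C, hC, isCompact_perforatedDisc.isClosed, ?_⟩
  rintro _ ⟨z, hz, rfl⟩ r hr hr1
  change ENNReal.ofReal _ ≤ (μHE[n].restrict (perforatedDisc n d))
    (Metric.ball (zeroExtension n d z) r) ∧ (μHE[n].restrict (perforatedDisc n d))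
    (Metric.ball (zeroExtension n d z) r) ≤ _
  rw [restrict_perforatedDisc hn, isClosedEmbedding_zeroExtension.measurableEmbedding.map_apply,
    (zeroExtension n d).isometry.preimage_ball]
  exact h z hz r hr hr1

theorem exists_satisfiesPoincare_perforatedDisc (hn : 2 ≤ n) :
    ∃ C lam : ℝ, 0 < C ∧ 1 ≤ lam ∧ SatisfiesPoincare n (perforatedDisc n d) C lam := by
  obtain ⟨C, hC, h⟩ := (isLinkedConvexFamily_beyondFace n hn).poincare volume
  rw [iUnion_beyondFace] at h
  refine ⟨C, 8 / (1 / 200), hC, by norm_num, ?_⟩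
  rintro _ ⟨z, hz, rfl⟩ r hr f ⟨K, hf⟩
  change ⨍ y in Metric.ball (zeroExtension n d z) r,
    |f y - ⨍ z in Metric.ball (zeroExtension n d z) r, f z ∂_| ∂_ ≤
      C * r * √(⨍ y in Metric.ball (zeroExtension n d z) _, _ ∂_)
  have he : MeasurableEmbedding (zeroExtension n d) :=
    isClosedEmbedding_zeroExtension.measurableEmbedding
  simp only [restrict_perforatedDisc_restrict_ball hn, he.average_map]
  refine (h z hz r hr (f ∘ zeroExtension n d)
    ⟨K * 1, hf.comp (zeroExtension n d).lipschitz⟩).trans_eq ?_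
  congr 2
  refine average_congr (ae_restrict_of_ae ?_)
  filter_upwards [ae_restrict_mem (isOpen_ball_diff_smallCube n hn).measurableSet] with y hy
  rw [norm_tangentialGradient_perforatedDisc hn hy]

theorem satisfiesCarleson_perforatedDisc (hn : 2 ≤ n) {ε : ℝ} (hε : 0 < ε) :
    SatisfiesCarleson n (perforatedDisc n d) ε := by
  intro x _
  set M := perforatedDisc n d
  have hT : ∃ A : Matrix (Fin (n + d)) (Fin (n + d)) ℝ,
      ∀ᵐ y ∂((μHE[n]).restrict M), tangentProjection n M y = A := by
    refine ⟨fun i j => (LinearMap.range (zeroExtension n d).toLinearMap).starProjection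
      (EuclideanSpace.single j 1) i, ?_⟩
    rw [restrict_perforatedDisc hn,
      isClosedEmbedding_zeroExtension.measurableEmbedding.ae_map_iff]
    filter_upwards [ae_restrict_mem (isOpen_ball_diff_smallCube n hn).measurableSet] with z hz
    have key : ∀ T : Submodule ℝ (EuclideanSpace ℝ (Fin (n + d))),
        T = LinearMap.range (zeroExtension n d).toLinearMap →
        (fun i j => T.starProjection (EuclideanSpace.single j 1) i :
          Matrix (Fin (n + d)) (Fin (n + d)) ℝ) = fun i j =>
        (LinearMap.range (zeroExtension n d).toLinearMap).starProjection
          (EuclideanSpace.single j 1) i := by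
      rintro _ rfl
      rfl
    exact key _ (approxTangentSpace_perforatedDisc hn hz)
  obtain ⟨A, hA⟩ := hT
  have hfin : IsFiniteMeasure ((μHE[n]).restrict M) := by
    rw [restrict_perforatedDisc hn]
    infer_instance
  have hzero : ∀ r, (⨍⁻ y in Metric.ball x r, ENNReal.ofReal (∑ i, ∑ j,
      (tangentProjection n M y i j - averageProjection n M x r i j) ^ 2)
        ∂((μHE[n]).restrict M)) = 0 := by
    intro r
    -- The average of a constant is that constant only for a nonzero measure; for the zero measure
    -- the outer average is 0 by convention.
    rcases eq_zero_or_neZero (((μHE[n]).restrict M).restrict (Metric.ball x r)) with h0 | h0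
    · rw [h0, laverage_zero_measure]
    have hr : ∀ᵐ y ∂(((μHE[n]).restrict M).restrict (Metric.ball x r)),
        tangentProjection n M y = A := ae_restrict_of_ae hA
    have havg : averageProjection n M x r = A := by
      ext i j
      rw [averageProjection, average_congr (g := fun _ => A i j), average_const]
      filter_upwards [hr] with y hy
      rw [hy]
    rw [laverage_congr (g := fun _ => 0)]
    · simp
    · filter_upwards [hr] with y hy
      simp [hy, havg]
  simp only [hzero, ENNReal.zero_div, lintegral_zero]
  exact ENNReal.ofReal_pos.2 (by positivity)

theorem zeroExtension_single_mem_perforatedDisc (hn : 0 < n) :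
    zeroExtension n d (EuclideanSpace.single ⟨0, hn⟩ (9 / 20)) ∈ perforatedDisc n d := by
  refine ⟨_, Metric.mem_closure_iff.2 fun ε hε => ?_, rfl⟩
  obtain ⟨δ, hδ⟩ : ∃ δ, δ = min (ε / 2) (1 / 10) := ⟨_, rfl⟩
  have hδ0 : 0 < δ := by rw [hδ]; positivity
  have hδ1 : δ ≤ ε / 2 := hδ ▸ min_le_left _ _
  have hδ2 : δ ≤ 1 / 10 := hδ ▸ min_le_right _ _
  refine ⟨EuclideanSpace.single ⟨0, hn⟩ (9 / 20 - δ), ⟨?_, fun hQ => ?_⟩, ?_⟩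
  · rw [mem_ball_zero_iff, PiLp.norm_single, Real.norm_eq_abs, abs_lt]
    constructor <;> linarith
  · have := hQ ⟨0, hn⟩
    rw [PiLp.single_apply, if_pos rfl, if_pos rfl, abs_le] at this
    linarith [this.1]
  · rw [PiLp.dist_single_same, Real.dist_eq, sub_sub_cancel, abs_of_pos hδ0]
    linarith

/-- An `n`-dimensional subspace contains a unit vector which is orthogonal to `n - 1` given
coordinate directions and has nonnegative component in another one. -/
theorem exists_unit_vector_mem {N : ℕ} {κ : Type*} [Fintype κ] (a : κ → Fin N) (b : Fin N)
    (P : Submodule ℝ (EuclideanSpace ℝ (Fin N))) (hP : Fintype.card κ < Module.finrank ℝ P) :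
    ∃ v ∈ P, ‖v‖ = 1 ∧ 0 ≤ v b ∧ ∀ i, v (a i) = 0 := by
  let L : P →ₗ[ℝ] (κ → ℝ) :=
    { toFun := fun v i => (v : EuclideanSpace ℝ (Fin N)) (a i)
      map_add' := fun _ _ => rfl
      map_smul' := fun _ _ => rfl }
  have hker : LinearMap.ker L ≠ ⊥ :=
    LinearMap.ker_ne_bot_of_finrank_lt (by rwa [Module.finrank_fintype_fun_eq_card])
  obtain ⟨v, hv, hv0⟩ := Submodule.exists_mem_ne_zero_of_ne_bot hker
  have hv1 : ∀ i, (v : EuclideanSpace ℝ (Fin N)) (a i) = 0 := fun i => congrFun hv i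
  have hvn : ‖(v : EuclideanSpace ℝ (Fin N))‖ ≠ 0 := by simpa using hv0
  have key : ∀ c : ℝ, |c| = ‖(v : EuclideanSpace ℝ (Fin N))‖⁻¹ →
      0 ≤ c * (v : EuclideanSpace ℝ (Fin N)) b →
      ∃ v ∈ P, ‖v‖ = 1 ∧ 0 ≤ v b ∧ ∀ i, v (a i) = 0 := fun c hc hb =>
    ⟨c • (v : EuclideanSpace ℝ (Fin N)), P.smul_mem c v.2, by
      rw [norm_smul, Real.norm_eq_abs, hc, inv_mul_cancel₀ hvn], hb, fun i => by simp [hv1 i]⟩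
  rcases le_total 0 ((v : EuclideanSpace ℝ (Fin N)) b) with hb | hb
  · exact key _ (abs_of_nonneg (by positivity)) (by positivity)
  · refine key (-‖(v : EuclideanSpace ℝ (Fin N))‖⁻¹) ?_ ?_
    · rw [abs_neg, abs_of_nonneg (by positivity)]
    · exact mul_nonneg_of_nonpos_of_nonpos (neg_nonpos.2 (by positivity)) hb

/-- The base point x₀ is the centre of the face of the cube nearest the origin. The n - 1 conditions
of being orthogonal to the directions of that face leave a unit vector v in the plane with v₀ ≥ 0. A
point of M closer than t to x₀ + tv would have to lie strictly on the side of the hole. -/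
theorem not_isReifenbergFlat_perforatedDisc (hn : 0 < n) {ε : ℝ} (hε : 0 < ε) (hε1 : ε < 1) :
    ¬ IsReifenbergFlat n (perforatedDisc n d) ε := by
  intro hflat
  set i₀ : Fin n := ⟨0, hn⟩
  set x₀ : EuclideanSpace ℝ (Fin n) := EuclideanSpace.single i₀ (9 / 20)
  obtain ⟨P, hdim, hxP, -, hP⟩ := hflat _ (zeroExtension_single_mem_perforatedDisc hn)
    (1 / 10 ^ 4) (by norm_num) le_rfl
  change zeroExtension n d x₀ ∈ P at hxP
  change ∀ y ∈ (P : Set _) ∩ Metric.ball (zeroExtension n d x₀) _, _ at hP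
  obtain ⟨v, hvP, hv1, hv0, hvi⟩ := exists_unit_vector_mem
    (fun i : {i : Fin n // i ≠ i₀} => Fin.castAdd d i.1) (Fin.castAdd d i₀) P.direction (by
      rw [hdim, Fintype.card_subtype_compl, Fintype.card_fin, Fintype.card_subtype_eq]
      omega)
  -- The midpoint of ε r and r for r = 10⁻⁴; it exists because ε < 1.
  obtain ⟨t, ht⟩ : ∃ t : ℝ, t = (1 + ε) / 2 * (1 / 10 ^ 4) := ⟨_, rfl⟩
  have ht0 : 0 < t := by rw [ht]; positivity
  have ht1 : t < 1 / 10 ^ 4 := by rw [ht]; linarith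
  have htε : ε * (1 / 10 ^ 4) < t := by rw [ht]; linarith
  have hqP : t • v + zeroExtension n d x₀ ∈ P :=
    AffineSubspace.vadd_mem_of_mem_direction (P.direction.smul_mem t hvP) hxP
  have hdist := hP _ ⟨hqP, by
    rw [Metric.mem_ball, dist_eq_norm, add_sub_cancel_right, norm_smul, hv1, mul_one,
      Real.norm_of_nonneg ht0.le]
    exact ht1⟩
  obtain ⟨_, ⟨w, hw, rfl⟩, hlt⟩ := (Metric.infDist_lt_iff
    ⟨_, zeroExtension_single_mem_perforatedDisc hn⟩).1 (hdist.trans_lt htε)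
  change dist _ (zeroExtension n d w) < t at hlt
  obtain ⟨u, hu⟩ : ∃ u, u = w - x₀ := ⟨_, rfl⟩
  have hlt' : ‖zeroExtension n d u - t • v‖ < t := by
    rw [dist_comm, dist_eq_norm] at hlt
    rwa [hu, map_sub, sub_sub, add_comm (zeroExtension n d x₀)]
  -- Only one coordinate survives: v vanishes along the face and u has no component in the last d
  -- directions.
  have hinner : inner ℝ (zeroExtension n d u) v = u i₀ * v (Fin.castAdd d i₀) := by
    rw [PiLp.inner_apply, Fin.sum_univ_add, Finset.sum_eq_single i₀]
    · simp [mul_comm]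
    · intro i _ hi
      simp [hvi ⟨i, hi⟩]
    · simp
  have hsq := norm_sub_sq_real (zeroExtension n d u) (t • v)
  rw [inner_smul_right, hinner, norm_smul, hv1, Real.norm_of_nonneg ht0.le, mul_one,
    LinearIsometry.norm_map] at hsq
  have hlt2 : ‖zeroExtension n d u - t • v‖ ^ 2 < t ^ 2 :=
    pow_lt_pow_left₀ hlt' (norm_nonneg _) two_ne_zero
  -- Expanding ‖u - tv‖² < t² leaves ‖u‖² < 2t⟨u, v⟩, so u₀v₀ > 0, while v₀ ≥ 0.
  have hu0 : 0 < u i₀ := by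
    have h1 : 0 < t * (u i₀ * v (Fin.castAdd d i₀)) := by nlinarith [sq_nonneg ‖u‖]
    exact pos_of_mul_pos_left (pos_of_mul_pos_right h1 ht0.le) hv0
  have hun : ‖u‖ < 2 * t := by
    have h1 := norm_le_norm_add_norm_sub' (zeroExtension n d u) (t • v)
    rw [norm_smul, hv1, Real.norm_of_nonneg ht0.le, mul_one, LinearIsometry.norm_map] at h1
    linarith
  have hui : ∀ i, |u i| < 2 / 10 ^ 4 := fun i =>
    (PiLp.norm_apply_le u i).trans_lt (by linarith)
  -- Since |uᵢ| < 2 · 10⁻⁴, the inequality can hold only in the first coordinate, where |u₀ - 1/20|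
  -- ≥ 1/20 contradicts 0 < u₀ < 1/10.
  obtain ⟨i, hi⟩ := exists_le_abs_of_mem_closure hw
  have hwi : w i = u i + if i = i₀ then 9 / 20 else 0 := by
    rw [hu, PiLp.sub_apply, PiLp.single_apply]; ring
  have h1 := abs_lt.1 (hui i)
  by_cases h : i = i₀
  · subst h
    rw [hwi, if_pos rfl, if_pos rfl] at hi
    rcases le_abs.1 hi with hi | hi <;> linarith
  · have h' : (i : ℕ) ≠ 0 := fun h0 => h (Fin.ext h0)
    rw [hwi, if_neg h, if_neg h'] at hi
    rcases le_abs.1 hi with hi | hi <;> linarith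

theorem perforatedDisc_subset_ball : perforatedDisc n d ⊆ Metric.ball 0 2 := by
  rintro _ ⟨z, hz, rfl⟩
  have h1 : ‖z‖ ≤ 1 := mem_closedBall_zero_iff.1
    (closure_minimal (sdiff_subset.trans Metric.ball_subset_closedBall)
      Metric.isClosed_closedBall hz)
  rw [mem_ball_zero_iff]
  exact ((zeroExtension n d).norm_map z).trans_lt (by linarith)

theorem zero_mem_perforatedDisc (hn : 0 < n) : 0 ∈ perforatedDisc n d := by
  refine ⟨0, subset_closure ⟨Metric.mem_ball_self one_pos, fun h => ?_⟩, map_zero (zeroExtension n d)⟩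
  have := h ⟨0, hn⟩
  norm_num at this

end PerforatedDisc

theorem theorem1 (n d : ℕ) (hn : 2 ≤ n) (hd : 1 ≤ d) :
    ∃ M : Set (EuclideanSpace ℝ (Fin (n + d))),
      M = perforatedDisc n d ∧
      (∀ ε : ℝ, 0 < ε → ε < 1 → ¬ IsReifenbergFlat n M ε) ∧
      M ⊆ Metric.ball 0 2 ∧
      (0 : EuclideanSpace ℝ (Fin (n + d))) ∈ M ∧
      IsCountablyRectifiable n M ∧
      ∃ C_M C_P lam : ℝ, 1 ≤ C_M ∧ 0 < C_P ∧ 1 ≤ lam ∧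
        IsAhlforsRegular n M C_M ∧
        SatisfiesPoincare n M C_P lam ∧
        ∀ ε₀ : ℝ, 0 < ε₀ → SatisfiesCarleson n M ε₀ := by
  obtain ⟨C_M, hC_M, hA⟩ := exists_isAhlforsRegular_perforatedDisc (d := d) hn
  obtain ⟨C_P, lam, hC_P, hlam, hPoin⟩ := exists_satisfiesPoincare_perforatedDisc (d := d) hn
  exact ⟨perforatedDisc n d, rfl,
    fun ε hε hε1 => not_isReifenbergFlat_perforatedDisc (by omega) hε hε1,
    perforatedDisc_subset_ball, zero_mem_perforatedDisc (by omega),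
    isCountablyRectifiable_perforatedDisc, C_M, C_P, lam, hC_M, hC_P, hlam, hA, hPoin,
    fun ε₀ hε₀ => satisfiesCarleson_perforatedDisc hn hε₀⟩
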